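/- **Asymptotic secrecy outage probability under simultaneous eavesdropping.** *RF links.* For $j\in\{R,E\}$ let $L_j\ge1$ be an integer, $\alpha_j,\kappa_j,\mu_j,D_j,\varrho_j>0$, and let $p\ge1$ be an integer. Let $q_j$ have the density $\sum_{i=1}^3 C_i D_j^{-\beta_i-1}q^{\beta_i}$ on $[0,D_j]$, $C=\frac1{72}(735,-1190,455)$, $\beta=(2,4,6)$. Put $V(k,p,v)=\frac{\Gamma(p+k)\,p^{1-2k}}{\Gamma(k+1)\Gamma(p-k+1)\Gamma(v+k+1)}$ and $I^{(p)}_v(x)=\sum_{k=0}^pV(k,p,v)(x/2)^{v+2k}$ (the order-$p$ approximation of the Bessel function $I_v$). With $\hat\mu_j=L_j\mu_j$ let $$f_{W_j}(w)=\frac{\hat\mu_j(1+\kappa_j)^{(\hat\mu_j+1)/2}}{\kappa_j^{(\hat\mu_j-1)/2}e^{\hat\mu_j\kappa_j}}\,w^{(\hat\mu_j-1)/2}e^{-\hat\mu_j(1+\kappa_j)w}\,I^{(p)}_{\hat\mu_j-1}\big(2\hat\mu_j\sqrt{\kappa_j(1+\kappa_j)w}\big),\quad w>0,$$ the $\kappa$-$\mu$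 power density of the $L_j$-branch MRC output. For average SNR $\bar\gamma_j$, $f_{\gamma_j}$ is the corresponding density of $\gamma_j=\varrho_jL_j\bar\gamma_j\,q_j^{-\alpha_j}W_j$ ($q_j,W_j$ independent), i.e. $f_{\gamma_j}(x)=\int_0^{D_j} f_{q_j}(q)\,s_q f_{W_j}(s_qx)\,dq$ with $s_q=q^{\alpha_j}/(\varrho_jL_j\bar\gamma_j)$, and $F_{\gamma_j}(x)=\int_0^xf_{\gamma_j}$. Put $\Psi_{i_j}=(\beta_{i_j}+1)/\alpha_j$, $$K_{1_j}=\frac{C_{i_j}V(k_j,p,L_j\mu_j-1)(L_j\mu_j\kappa_j)^{k_j}}{\alpha_je^{L_j\mu_j\kappa_j}},\qquad K_{2_j}=\frac{L_j\mu_j(1+\kappa_j)D_j^{\alpha_j}}{\varrho_jL_j\bar\gamma_j}.$$ *Optical links.* For $n\in\{D,\tilde E\}$ let $Y_n$ be the product of the independent gains of the relay-surface hop $I$ (the same parameters for both $n$) and of the surface-$n$ hop. The gain of a hop is the product of two independent variables: a turbulence gain with density $\frac{w}{\nu}e^{-x/\nu}+(1-w)\frac{c\,x^{ac-1}}{b^{ac}\Gamma(a)}e^{-(x/b)^c}$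 on $(0,\infty)$ and a pointing gain with density $\frac{\xi^2}{J^{\xi^2}}x^{\xi^2-1}$ on $(0,J]$, where $0<w<1$ and $\nu,a,b,c,\xi,J>0$ belong to the hop. With $\mathcal N\ge1$ reflecting elements put $\rho_n=\frac{(\mathcal N\,\mathbb E Y_n)^2}{\mathcal N\,\mathrm{Var}\,Y_n}$, $w_n=\frac{\mathrm{Var}\,Y_n}{\mathbb EY_n}$ (the Gamma approximation of the sum of $\mathcal N$ independent copies of $Y_n$). For $r_n\in\{1,2\}$ and electrical SNR $\tau_n>0$ put $$\Upsilon_{1_n}=\frac{(\mathbb EY_n)^{\rho_n}}{r_n\Gamma(\rho_n)w_n^{\rho_n}\tau_n^{\rho_n/r_n}},\quad \Upsilon_{2_n}=\frac{\mathbb EY_n}{w_n\tau_n^{1/r_n}},\quad \Upsilon_{3_n}=\frac{(\mathbb EY_n)^{\rho_n}}{\sqrt{r_n}\,\Gamma(\rho_n)w_n^{\rho_n}\tau_n^{\rho_n/r_n}(2\pi)^{(r_n-1)/2}},\quad \Upsilon_{4_n}=\frac{(\mathbb EY_n)^{r_n}}{r_n^{r_n}w_n^{r_n}\tau_n},$$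 $\Upsilon_{5_n}=\frac{r_n-1}{r_n}$. The SNR $\gamma_n$ has density $f_{\gamma_n}(x)=\Upsilon_{1_n}x^{\rho_n/r_n-1}\exp(-\Upsilon_{2_n}x^{1/r_n})$, $x>0$, and distribution function $F_{\gamma_n}(x)=\int_0^xf_{\gamma_n}$. *Secrecy outage.* Let $\mathcal R_s>0$, $\phi=2^{\mathcal R_s}$. The lower bound of the secrecy outage probability with both links wiretapped is $SOP^{III}_L=1-SOP_1\,SOP_2$, where $$SOP_1=1-\int_0^\infty F_{\gamma_R}(\phi x)f_{\gamma_E}(x)\,dx,\qquad SOP_2=1-\int_0^\infty F_{\gamma_D}(\phi x)f_{\gamma_{\tilde E}}(x)\,dx .$$ *Asymptotic expressions.* Let $SOP^\infty_{III}=1-SOP_1^\infty SOP_2^\infty$, where $$SOP_1^\infty=1-\sum_{i_R=1}^3\sum_{k_R=0}^pK_{1_R}\sum_{i_E=1}^3\sum_{k_E=0}^pK_{1_E}\sum_{k=1}^2\Big(\frac{K_{2_E}}{\phi K_{2_R}}\Big)^{T_{6,k}-1}\frac{\prod_{l=1,\,l\ne k}^2\Gamma(T_{6,k}-T_{6,l})\prod_{l=1}^3\Gamma(1+T_{7,l}-T_{6,k})}{\prod_{l=3}^4\Gamma(1+T_{6,l}-T_{6,k})\;\Gamma(T_{6,k}+\Psi_{i_E})},$$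 with $T_6=(1-\Psi_{i_E},\,1-L_R\mu_R-k_R,\,1,\,1+\Psi_{i_R})$, $T_7=(L_E\mu_E+k_E,\,\Psi_{i_R},\,0)$, and $$SOP_2^\infty=1-\phi^{\rho_D/r_D}\Upsilon_{3_D}\Upsilon_{1_{\tilde E}}\frac{r_{\tilde E}^{1/2}(\phi\Upsilon_{4_D})^{-\zeta}}{(2\pi)^{(r_{\tilde E}-1)/2}}\sum_{k=1}^{r_D}\Omega^{T_{4,k}-1}\frac{\prod_{l=1,\,l\neq k}^{r_D}\Gamma(T_{4,k}-T_{4,l})\prod_{l=1}^{r_{\tilde E}+1}\Gamma(1+T_{5,l}-T_{4,k})}{\Gamma(1+T_{4,r_D+1}-T_{4,k})},$$ with $\zeta=\frac{\rho_D}{r_D}+\frac{\rho_{\tilde E}}{r_{\tilde E}}$, $\Omega=\frac{\Upsilon_{2_{\tilde E}}^{r_{\tilde E}}r_{\tilde E}^{-r_{\tilde E}}}{\phi\Upsilon_{4_D}}$; $T_4=(1-\zeta,\,1-\frac{\rho_{\tilde E}}{r_{\tilde E}})$ if $r_D=1$ and $T_4=(1-\zeta,\,1-\zeta-\Upsilon_{5_D},\,1-\frac{\rho_{\tilde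 E}}{r_{\tilde E}})$ if $r_D=2$; $T_5=(0,-\frac{\rho_{\tilde E}}{r_{\tilde E}})$ if $r_{\tilde E}=1$ and $T_5=(0,\Upsilon_{5_{\tilde E}},-\frac{\rho_{\tilde E}}{r_{\tilde E}})$ if $r_{\tilde E}=2$. *Claim.* Fix all parameters, including the eavesdroppers' SNRs $\bar\gamma_E,\tau_{\tilde E}>0$, and assume that no $\Psi_{i_E}-L_R\mu_R$ ($i_E=1,2,3$) is an integer (equivalently, every Gamma function in $SOP_1^\infty$ is evaluated away from its poles). Then at high SNR of the legitimate links: 1. $SOP^{III}_L\sim SOP^\infty_{III}$ (ratio tending to $1$) as $(\bar\gamma_R,\tau_D)\to(\infty,\infty)$; 2. $1-SOP_1\sim1-SOP_1^\infty$ as $\bar\gamma_R\to\infty$, and $1-SOP_2\sim1-SOP_2^\infty$ as $\tau_D\to\infty$; 3. $SOP_1-SOP_1^\infty=O\big(\bar\gamma_R^{-(L_R\mu_R+1)}\big)$ as $\bar\gamma_R\to\infty$, and $SOP_2-SOP_2^\infty=O\big(\tau_D^{-(\rho_D/r_D+1)}\big)$ as $\tau_D\to\infty$. -/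

import Mathlib

noncomputable section

open MeasureTheory Filter Asymptotics

/-! ## Radio-frequency links (source to relay, source to eavesdropper) -/

/-- Parameters of an RF link: number `L` of MRC branches, path-loss exponent `α`, fading
parameters `κ`, `μ`, radius `D` of the random-waypoint sphere, and link-budget constant `ϱ`. -/
structure RFLink where
  L : ℕ
  α : ℝ
  κ : ℝ
  μ : ℝ
  D : ℝ
  ϱ : ℝ
  L_pos : 1 ≤ L
  α_pos : 0 < α
  κ_pos : 0 < κ
  μ_pos : 0 < μ
  D_pos : 0 < D
  ϱ_pos : 0 < ϱ

/-- Coefficients `C_i` of the three-dimensional random-waypoint distance density. -/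
def rwpC : Fin 3 → ℝ := ![735 / 72, -1190 / 72, 455 / 72]

/-- Exponents `β_i` of the three-dimensional random-waypoint distance density. -/
def rwpBeta : Fin 3 → ℝ := ![2, 4, 6]

/-- Density on `[0, D]` of the random-waypoint distance `q`. -/
def rwpPDF (D q : ℝ) : ℝ :=
  ∑ i, rwpC i / D ^ (rwpBeta i + 1) * q ^ rwpBeta i

/-- Coefficients `V(k, p, v)` of the order-`p` approximation of the modified Bessel function. -/
def besselV (k p : ℕ) (v : ℝ) : ℝ :=
  Real.Gamma ((p : ℝ) + k) * (p : ℝ) ^ (1 - 2 * (k : ℤ)) /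
    (Real.Gamma ((k : ℝ) + 1) * Real.Gamma ((p : ℝ) - k + 1) * Real.Gamma (v + k + 1))

/-- The order-`p` finite-sum approximation of the modified Bessel function `I_v`. -/
def besselIApprox (p : ℕ) (v x : ℝ) : ℝ :=
  ∑ k ∈ Finset.range (p + 1), besselV k p v * (x / 2) ^ (v + 2 * (k : ℝ))

/-- Density of the `κ`-`μ` power gain `W = |h|²`, with the order-`p` Bessel approximation. -/
def kappaMuPowerPDF (p : ℕ) (κ μ w : ℝ) : ℝ :=
  2 * μ * (1 + κ) ^ ((μ + 1) / 2) / (κ ^ ((μ - 1) / 2) * Real.exp (μ * κ)) / 2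
    * w ^ ((μ - 1) / 2) * Real.exp (-(μ * (1 + κ)) * w)
    * besselIApprox p (μ - 1) (2 * μ * √(κ * (1 + κ)) * √w)

namespace RFLink

/-- The MRC output fades as a `κ`-`μ` channel whose parameter `μ` is multiplied by `L`. -/
def μMRC (j : RFLink) : ℝ := j.L * j.μ

/-- The constant `B = μ (1 + κ)` of the `κ`-`μ` density, at the MRC value of `μ`. -/
def B (j : RFLink) : ℝ := j.μMRC * (1 + j.κ)

/-- Density of the MRC output SNR `γ = ϱ (L γ̄) q^{-α} W` for average SNR `γ̄` per branch, where
`q` is the random-waypoint distance and `W` the `κ`-`μ` power gain at the MRC value of `μ`: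
the conditional density given `q`, averaged over `q`. -/
def snrPDF (j : RFLink) (p : ℕ) (γbar x : ℝ) : ℝ :=
  ∫ q in (0 : ℝ)..j.D, rwpPDF j.D q *
    (q ^ j.α / (j.ϱ * (j.L * γbar)) *
      kappaMuPowerPDF p j.κ j.μMRC (x * (q ^ j.α / (j.ϱ * (j.L * γbar)))))

/-- Distribution function of the MRC output SNR. -/
def snrCDF (j : RFLink) (p : ℕ) (γbar x : ℝ) : ℝ :=
  ∫ t in (0 : ℝ)..x, j.snrPDF p γbar t

/-- `Ψ_i = (β_i + 1) / α`. -/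
def Ψ (j : RFLink) (i : Fin 3) : ℝ := (rwpBeta i + 1) / j.α

/-- `K₁ = C_i V(k, p, L μ - 1) (L μ κ)^k / (α exp(L μ κ))`. -/
def K₁ (j : RFLink) (p : ℕ) (i : Fin 3) (k : ℕ) : ℝ :=
  1 / (j.α * Real.exp (j.L * j.μ * j.κ)) * rwpC i * besselV k p (j.L * j.μ - 1) *
    (j.L * j.μ * j.κ) ^ k

/-- `K₂ = B D^α / (ϱ L γ̄)`. -/
def K₂ (j : RFLink) (γbar : ℝ) : ℝ := j.B * j.D ^ j.α / (j.ϱ * j.L * γbar)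

end RFLink

/-! ## Optical links (relay to surface to destination, or to eavesdropper) -/

/-- Parameters of one underwater optical hop: mixture weight `w`, exponential mean `ν`,
generalized-Gamma parameters `a`, `b`, `c`, pointing error `ξ` and pointing loss `J`. -/
structure OpticalHop where
  w : ℝ
  ν : ℝ
  a : ℝ
  b : ℝ
  c : ℝ
  ξ : ℝ
  J : ℝ
  w_pos : 0 < w
  w_lt_one : w < 1
  ν_pos : 0 < ν
  a_pos : 0 < a
  b_pos : 0 < b
  c_pos : 0 < c
  ξ_pos : 0 < ξ
  J_pos : 0 < J

namespace OpticalHop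

/-- Mixture exponential-generalized-Gamma density on `(0, ∞)`. -/
def turbulencePDF (h : OpticalHop) (x : ℝ) : ℝ :=
  h.w * (1 / h.ν * Real.exp (-(x / h.ν))) +
    (1 - h.w) * (h.c * x ^ (h.a * h.c - 1) / (h.b ^ (h.a * h.c) * Real.Gamma h.a) *
      Real.exp (-((x / h.b) ^ h.c)))

/-- Pointing-error density on `(0, J]`. -/
def pointingPDF (h : OpticalHop) (x : ℝ) : ℝ :=
  h.ξ ^ 2 / h.J ^ (h.ξ ^ 2) * x ^ (h.ξ ^ 2 - 1)

/-- Law of the gain of the hop: the product of independent turbulence and pointing gains. -/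
def gainLaw (h : OpticalHop) : Measure ℝ :=
  Measure.map (fun z : ℝ × ℝ => z.1 * z.2)
    (((volume.restrict (Set.Ioi 0)).withDensity fun x => ENNReal.ofReal (h.turbulencePDF x)).prod
      ((volume.restrict (Set.Ioc 0 h.J)).withDensity fun x => ENNReal.ofReal (h.pointingPDF x)))

end OpticalHop

/-- An optical link through a reflecting surface with `N` elements: hop into the surface, hop out
of it, and detection method `r` (`1`: heterodyne, `2`: intensity modulation, direct detection). -/
structure RISLink where
  hopIn : OpticalHop
  hopOut : OpticalHop
  N : ℕ
  r : ℕ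
  N_pos : 1 ≤ N
  r_eq : r = 1 ∨ r = 2

namespace RISLink

/-- `E(Y^s)`, where `Y` is the product of the independent gains of the two hops. -/
def moment (n : RISLink) (s : ℕ) : ℝ :=
  ∫ z : ℝ × ℝ, (z.1 * z.2) ^ s ∂(n.hopIn.gainLaw.prod n.hopOut.gainLaw)

/-- `E(χ)` for the sum `χ` of `N` independent copies of `Y`. -/
def meanχ (n : RISLink) : ℝ := n.N * n.moment 1

/-- `Var(χ)` for the sum `χ` of `N` independent copies of `Y`. -/
def varχ (n : RISLink) : ℝ := n.N * (n.moment 2 - n.moment 1 ^ 2)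

/-- Shape parameter of the Gamma law that approximates `χ`. -/
def ρ (n : RISLink) : ℝ := n.meanχ ^ 2 / n.varχ

/-- Scale parameter of the Gamma law that approximates `χ`. -/
def ω (n : RISLink) : ℝ := n.varχ / n.meanχ

/-- `Υ₁`, as a function of the electrical SNR `τ`. -/
def Υ₁ (n : RISLink) (τ : ℝ) : ℝ :=
  n.moment 1 ^ n.ρ / (n.r * Real.Gamma n.ρ * n.ω ^ n.ρ * τ ^ (n.ρ / n.r))

/-- `Υ₂`, as a function of the electrical SNR `τ`. -/
def Υ₂ (n : RISLink) (τ : ℝ) : ℝ := n.moment 1 / (n.ω * τ ^ (1 / (n.r : ℝ)))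

/-- `Υ₃`, as a function of the electrical SNR `τ`. -/
def Υ₃ (n : RISLink) (τ : ℝ) : ℝ :=
  n.moment 1 ^ n.ρ / (√n.r * Real.Gamma n.ρ * n.ω ^ n.ρ * τ ^ (n.ρ / n.r) *
    (2 * Real.pi) ^ (((n.r : ℝ) - 1) / 2))

/-- `Υ₄`, as a function of the electrical SNR `τ`. -/
def Υ₄ (n : RISLink) (τ : ℝ) : ℝ :=
  n.moment 1 ^ n.r / ((n.r : ℝ) ^ n.r * n.ω ^ n.r * τ)

/-- `Υ₅ = (r - 1) / r`. -/
def Υ₅ (n : RISLink) : ℝ := ((n.r : ℝ) - 1) / n.r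

/-- Density of the SNR of the link at electrical SNR `τ`. The exponential is the Meijer function
`G^{1,0}_{0,1}[z | - ; 0] = exp(-z)` at `z = Υ₂ x^{1/r}`. -/
def snrPDF (n : RISLink) (τ x : ℝ) : ℝ :=
  n.Υ₁ τ * x ^ (n.ρ / n.r - 1) * Real.exp (-(n.Υ₂ τ * x ^ (1 / (n.r : ℝ))))

/-- Distribution function of the SNR of the link. -/
def snrCDF (n : RISLink) (τ x : ℝ) : ℝ := ∫ t in (0 : ℝ)..x, n.snrPDF τ t

end RISLink

/-! ## Secrecy outage under simultaneous eavesdropping -/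

/-- `SOP₁ = 1 - ∫₀^∞ F_{γ_R}(φ x) f_{γ_E}(x) dx`. -/
def SOP₁ (p : ℕ) (φ : ℝ) (R E : RFLink) (γR γE : ℝ) : ℝ :=
  1 - ∫ x in Set.Ioi (0 : ℝ), R.snrCDF p γR (φ * x) * E.snrPDF p γE x

/-- `SOP₂ = 1 - ∫₀^∞ F_{γ_D}(φ x) f_{γ_Ẽ}(x) dx`. -/
def SOP₂ (φ : ℝ) (D E' : RISLink) (τD τE : ℝ) : ℝ :=
  1 - ∫ x in Set.Ioi (0 : ℝ), D.snrCDF τD (φ * x) * E'.snrPDF τE x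

/-- The (lower bound of the) secrecy outage probability `1 - SOP₁ SOP₂`. -/
def SOPIII (p : ℕ) (φ : ℝ) (R E : RFLink) (D E' : RISLink) (γR γE τD τE : ℝ) : ℝ :=
  1 - SOP₁ p φ R E γR γE * SOP₂ φ D E' τD τE

/-- `T₆ = (1 - Ψ_E, 1 - L_R μ_R - k_R, 1, 1 + Ψ_R)`, entries numbered from `1`. -/
def T₆ (R E : RFLink) (iR : Fin 3) (kR : ℕ) (iE : Fin 3) : ℕ → ℝ
  | 1 => 1 - E.Ψ iE
  | 2 => 1 - R.L * R.μ - kR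
  | 3 => 1
  | 4 => 1 + R.Ψ iR
  | _ => 0

/-- `T₇ = (L_E μ_E + k_E, Ψ_R, 0)`, entries numbered from `1`. -/
def T₇ (R E : RFLink) (iR : Fin 3) (kE : ℕ) : ℕ → ℝ
  | 1 => E.L * E.μ + kE
  | 2 => R.Ψ iR
  | _ => 0

/-- The explicit expression `SOP₁^∞`. -/
def SOP₁Inf (p : ℕ) (φ : ℝ) (R E : RFLink) (γR γE : ℝ) : ℝ :=
  1 - ∑ iR : Fin 3, ∑ kR ∈ Finset.range (p + 1), R.K₁ p iR kR *
    ∑ iE : Fin 3, ∑ kE ∈ Finset.range (p + 1), E.K₁ p iE kE *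
      ∑ k ∈ Finset.Icc 1 2,
        (E.K₂ γE / (φ * R.K₂ γR)) ^ (T₆ R E iR kR iE k - 1) *
          (((∏ l ∈ (Finset.Icc 1 2).erase k,
                Real.Gamma (T₆ R E iR kR iE k - T₆ R E iR kR iE l)) *
              ∏ l ∈ Finset.Icc 1 3,
                Real.Gamma (1 + T₇ R E iR kE l - T₆ R E iR kR iE k)) /
            ((∏ l ∈ Finset.Icc 3 4,
                Real.Gamma (1 + T₆ R E iR kR iE l - T₆ R E iR kR iE k)) *
              Real.Gamma (T₆ R E iR kR iE k + E.Ψ iE)))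

/-- `ζ = ρ_D / r_D + ρ_Ẽ / r_Ẽ`. -/
def zetaOpt (D E' : RISLink) : ℝ := D.ρ / D.r + E'.ρ / E'.r

/-- `T₄ = (1 - ζ, 1 - ρ_Ẽ / r_Ẽ)` if `r_D = 1` and
`T₄ = (1 - ζ, 1 - ζ - Υ₅, 1 - ρ_Ẽ / r_Ẽ)` if `r_D = 2`, entries numbered from `1`. -/
def T₄ (D E' : RISLink) (k : ℕ) : ℝ :=
  if k = 1 then 1 - zetaOpt D E'
  else if k ≤ D.r then 1 - zetaOpt D E' - D.Υ₅
  else 1 - E'.ρ / E'.r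

/-- `T₅ = (0, -ρ_Ẽ / r_Ẽ)` if `r_Ẽ = 1` and `T₅ = (0, Υ₅, -ρ_Ẽ / r_Ẽ)` if `r_Ẽ = 2`,
entries numbered from `1`. -/
def T₅ (E' : RISLink) (l : ℕ) : ℝ :=
  if l = 1 then 0
  else if l ≤ E'.r then E'.Υ₅
  else -(E'.ρ / E'.r)

/-- `Ω₁₈ = Υ₂^{r_Ẽ} r_Ẽ^{-r_Ẽ} / (φ Υ₄)`. -/
def Ω₁₈ (φ : ℝ) (D E' : RISLink) (τD τE : ℝ) : ℝ :=
  E'.Υ₂ τE ^ E'.r / (E'.r : ℝ) ^ E'.r / (φ * D.Υ₄ τD)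

/-- The explicit expression `SOP₂^∞`. -/
def SOP₂Inf (φ : ℝ) (D E' : RISLink) (τD τE : ℝ) : ℝ :=
  1 - φ ^ (D.ρ / D.r) * D.Υ₃ τD * E'.Υ₁ τE *
    (√E'.r * (φ * D.Υ₄ τD) ^ (-zetaOpt D E') / (2 * Real.pi) ^ (((E'.r : ℝ) - 1) / 2)) *
    ∑ k ∈ Finset.Icc 1 D.r,
      Ω₁₈ φ D E' τD τE ^ (T₄ D E' k - 1) *
        (((∏ l ∈ (Finset.Icc 1 D.r).erase k, Real.Gamma (T₄ D E' k - T₄ D E' l)) *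
            ∏ l ∈ Finset.Icc 1 (E'.r + 1), Real.Gamma (1 + T₅ E' l - T₄ D E' k)) /
          ∏ l ∈ Finset.Icc (D.r + 1) (D.r + 1), Real.Gamma (1 + T₄ D E' l - T₄ D E' k))

/-- The explicit expression `1 - SOP₁^∞ SOP₂^∞`. -/
def SOPIIIInf (p : ℕ) (φ : ℝ) (R E : RFLink) (D E' : RISLink) (γR γE τD τE : ℝ) : ℝ :=
  1 - SOP₁Inf p φ R E γR γE * SOP₂Inf φ D E' τD τE

end

open MeasureTheory Filter Asymptotics

/-! RF links. Averaging over the distance turns each SNR law into a finite signed combination of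
laws of `X / S`, with `X` Gamma of shape `a = L μ + k` and `S` on `(0, 1)` with density proportional
to `s ^ (Ψ - 1)` (`ratioPDF`, `ratioCDF`). The average SNR enters only as a scale, so `1 - SOP₁` is
a finite combination of `ratioIntegral`s at `δ = φ K₂_R / K₂_E`, a constant over `γR`. Since
`ratioCDF` is `u ^ a` times a mixture of exponentials, Tonelli turns each integral into `Γ(a + a') δ
^ a` times a weighted average over `w` of `∫₀¹ s ^ (A - 1) (s + w δ) ^ (-N) ds`, where `A - N = Ψ' -
a`. At small `η` this truncated Beta integral is `η ^ (A - N) Γ(A) Γ(N - A) / Γ(N) + 1 / (A - N) +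
O(η)` (`truncBeta_expansion`). Integrating in `w` leaves a `δ ^ Ψ'` term and a `δ ^ a` term with
error `O(δ ^ (a + 1))`; these two terms are exactly the two residues in `SOP₁Inf`
(`one_sub_SOP₁Inf_eq`).

Optical links. The exponential in the density of `γ_D` is expanded to `r_D` terms, and each term
integrates to a moment of the eavesdropper's SNR. The remainder carries `Υ₁ Υ₂ ^ r_D`, of order `τD
^ (-(ρ / r + 1))`. The duplication formula identifies the truncated sum with `SOP₂Inf`
(`one_sub_SOP₂Inf_eq`).

From differences to ratios. The coefficients `C_i` have mixed signs, so the expansion alone does not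
exclude cancellation of leading terms. Positivity of the densities does: it bounds `1 - SOP₁` and `1
- SOP₂` below by multiples of `γR ^ (-L μ)` and `τD ^ (-ρ / r)`, one power above the errors. Finally
`1 - S₁ S₂ = (1 - S₁) + (1 - S₂) S₁` is a sum of eventually nonnegative terms, so relative errors
add without loss, however the two SNRs grow. -/

/-! ### Tonelli interchange and the truncated Beta integral at small `η`. -/

theorem integrable_and_integral_integral_eq_of_nonneg {α β : Type*} [MeasurableSpace α]
    [MeasurableSpace β] {μ : Measure α} {ν : Measure β} [SFinite μ] [SFinite ν]
    {f : α → β → ℝ} {h : β → ℝ} (hf : AEStronglyMeasurable (Function.uncurry f) (μ.prod ν))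
    (hpos : ∀ᵐ y ∂ν, ∀ᵐ x ∂μ, 0 ≤ f x y) (hin : ∀ᵐ y ∂ν, Integrable (fun x => f x y) μ)
    (hh : ∀ᵐ y ∂ν, ∫ x, f x y ∂μ = h y) (hint : Integrable h ν) :
    Integrable (fun x => ∫ y, f x y ∂ν) μ ∧ ∫ x, ∫ y, f x y ∂ν ∂μ = ∫ y, h y ∂ν := by
  have hI : Integrable (Function.uncurry f) (μ.prod ν) := by
    rw [integrable_prod_iff' hf]
    refine ⟨hin, hint.congr ?_⟩
    filter_upwards [hpos, hh] with y hy hy'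
    rw [← hy']
    refine integral_congr_ae ?_
    filter_upwards [hy] with x hx
    simp [abs_of_nonneg hx]
  refine ⟨hI.integral_prod_left, ?_⟩
  rw [integral_integral_swap hI]
  exact integral_congr_ae hh

theorem integrableOn_rpow_mul_exp_neg_mul {a r : ℝ} (ha : 0 < a) (hr : 0 < r) :
    IntegrableOn (fun x : ℝ => x ^ (a - 1) * Real.exp (-(r * x))) (Set.Ioi 0) := by
  simpa using integrableOn_rpow_mul_exp_neg_mul_rpow (s := a - 1) (by linarith) one_pos hr

/-- Writing `Γ(N) (s + η) ^ (-N)` as the Gamma integral `∫ y ^ (N - 1) e ^ (-(s + η) y) dy` and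
integrating in `s` first leaves another Gamma integral, of shape `N - A`. -/
theorem integrableOn_and_integral_rpow_mul_add_rpow {A N η : ℝ} (hA : 0 < A) (hN : A < N)
    (hη : 0 < η) :
    IntegrableOn (fun s : ℝ => s ^ (A - 1) * (s + η) ^ (-N)) (Set.Ioi 0) ∧
      ∫ s in Set.Ioi (0 : ℝ), s ^ (A - 1) * (s + η) ^ (-N) =
        η ^ (A - N) * (Real.Gamma A * Real.Gamma (N - A) / Real.Gamma N) := by
  have hN0 : 0 < N := hA.trans hN
  have hΓ : 0 < Real.Gamma N := Real.Gamma_pos_of_pos hN0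
  have key := integrable_and_integral_integral_eq_of_nonneg
    (μ := volume.restrict (Set.Ioi (0 : ℝ))) (ν := volume.restrict (Set.Ioi (0 : ℝ)))
    (f := fun s y => s ^ (A - 1) * (y ^ (N - 1) * Real.exp (-((s + η) * y))))
    (h := fun y => Real.Gamma A * (y ^ (N - A - 1) * Real.exp (-(η * y))))
    (by
      refine Measurable.aestronglyMeasurable ?_
      unfold Function.uncurry
      fun_prop)
    (by
      filter_upwards [ae_restrict_mem measurableSet_Ioi] with y hy
      filter_upwards [ae_restrict_mem measurableSet_Ioi] with x hx
      have hx : 0 < x := hx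
      have hy : 0 < y := hy
      positivity)
    (by
      filter_upwards [ae_restrict_mem measurableSet_Ioi] with y hy
      refine ((integrableOn_rpow_mul_exp_neg_mul hA hy).const_mul
        (y ^ (N - 1) * Real.exp (-(η * y)))).congr (ae_of_all _ fun s => ?_)
      simp only
      rw [show -((s + η) * y) = -(η * y) + -(y * s) by ring, Real.exp_add]
      ring)
    (by
      filter_upwards [ae_restrict_mem measurableSet_Ioi] with y hy
      have hy : 0 < y := hy
      have : ∀ s : ℝ, s ^ (A - 1) * (y ^ (N - 1) * Real.exp (-((s + η) * y))) =
          y ^ (N - 1) * Real.exp (-(η * y)) * (s ^ (A - 1) * Real.exp (-(y * s))) := fun s => by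
        rw [show -((s + η) * y) = -(η * y) + -(y * s) by ring, Real.exp_add]
        ring
      simp_rw [this]
      rw [integral_const_mul, Real.integral_rpow_mul_exp_neg_mul_Ioi hA hy, one_div,
        Real.inv_rpow hy.le, ← Real.rpow_neg hy.le,
        show N - A - 1 = (N - 1) + -A by ring, Real.rpow_add hy]
      ring)
    ((integrableOn_rpow_mul_exp_neg_mul (sub_pos.2 hN) hη).const_mul _)
  have hin : ∀ s ∈ Set.Ioi (0 : ℝ),
      ∫ y in Set.Ioi (0 : ℝ), s ^ (A - 1) * (y ^ (N - 1) * Real.exp (-((s + η) * y))) =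
        Real.Gamma N * (s ^ (A - 1) * (s + η) ^ (-N)) := fun s hs => by
    have hs : 0 < s := hs
    have hsη : 0 < s + η := by positivity
    rw [integral_const_mul, Real.integral_rpow_mul_exp_neg_mul_Ioi hN0 hsη, one_div,
      Real.inv_rpow hsη.le, ← Real.rpow_neg hsη.le]
    ring
  obtain ⟨k1, k2⟩ := key
  constructor
  · have := (k1.congr ((ae_restrict_mem measurableSet_Ioi).mono fun s hs => hin s hs)).const_mul
      (Real.Gamma N)⁻¹
    refine this.congr (ae_of_all _ fun s => ?_)
    simp only
    field_simp
  · rw [setIntegral_congr_fun measurableSet_Ioi hin, integral_const_mul, integral_const_mul,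
      Real.integral_rpow_mul_exp_neg_mul_Ioi (sub_pos.2 hN) hη, one_div,
      Real.inv_rpow hη.le, ← Real.rpow_neg hη.le, neg_sub] at k2
    rw [eq_comm, ← mul_right_inj' hΓ.ne', k2]
    field_simp

/-- The truncated Beta integral `∫₀¹ s^{A-1} (s + η)^{-N} ds`. -/
noncomputable def truncBeta (A N η : ℝ) : ℝ := ∫ s in (0 : ℝ)..1, s ^ (A - 1) * (s + η) ^ (-N)

theorem intervalIntegrable_rpow_mul_add_rpow {A η : ℝ} (N : ℝ) (hA : 0 < A) (hη : 0 < η) :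
    IntervalIntegrable (fun s : ℝ => s ^ (A - 1) * (s + η) ^ (-N)) volume 0 1 := by
  refine (intervalIntegral.intervalIntegrable_rpow' (by linarith)).mul_continuousOn ?_
  refine ContinuousOn.rpow_const (by fun_prop) fun s hs => Or.inl ?_
  rw [Set.uIcc_of_le zero_le_one] at hs
  linarith [hs.1]

theorem truncBeta_nonneg {A N η : ℝ} (hη : 0 < η) : 0 ≤ truncBeta A N η :=
  intervalIntegral.integral_nonneg zero_le_one fun s hs => by
    have := hs.1
    positivity

/-- Integrate the derivative of `s ^ A (s + η) ^ (-N)` over `[0, 1]`, splitting `s = (s + η) - η`.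
Increasing `N` costs a factor `η`, which is what lets a bound at `N + 1` become an expansion at `N`.
-/
theorem truncBeta_recursion {A N η : ℝ} (hA : 0 < A) (hη : 0 < η) :
    (A - N) * truncBeta A N η = (1 + η) ^ (-N) - N * η * truncBeta A (N + 1) η := by
  have hF : ∫ s in (0 : ℝ)..1, ((A - N) * (s ^ (A - 1) * (s + η) ^ (-N)) +
      N * η * (s ^ (A - 1) * (s + η) ^ (-(N + 1)))) =
      (1 : ℝ) ^ A * (1 + η) ^ (-N) - (0 : ℝ) ^ A * (0 + η) ^ (-N) := by
    refine intervalIntegral.integral_eq_sub_of_hasDerivAt_of_le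
      (f := fun s : ℝ => s ^ A * (s + η) ^ (-N)) zero_le_one ?_ ?_ ?_
    · refine ContinuousOn.mul (Continuous.continuousOn (Real.continuous_rpow_const hA.le)) ?_
      refine ContinuousOn.rpow_const (by fun_prop) fun s hs => Or.inl ?_
      linarith [hs.1]
    · intro s hs
      have hs0 : 0 < s := hs.1
      have hsη : 0 < s + η := by positivity
      have h1 := (Real.hasDerivAt_rpow_const (p := A) (Or.inl hs0.ne')).mul
        (((hasDerivAt_id s).add_const η).rpow_const (p := -N) (Or.inl hsη.ne'))
      have e1 : (s + η) ^ (-N) = (s + η) ^ (-(N + 1)) * (s + η) := by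
        rw [← Real.rpow_add_one hsη.ne']
        ring_nf
      have e2 : s ^ A = s ^ (A - 1) * s := by
        rw [← Real.rpow_add_one hs0.ne', sub_add_cancel]
      refine h1.congr_deriv ?_
      rw [id, e2, e1, show -N - 1 = -(N + 1) by ring]
      ring
    · exact ((intervalIntegrable_rpow_mul_add_rpow N hA hη).const_mul _).add
        ((intervalIntegrable_rpow_mul_add_rpow (N + 1) hA hη).const_mul _)
  rw [intervalIntegral.integral_add
    ((intervalIntegrable_rpow_mul_add_rpow N hA hη).const_mul _)
    ((intervalIntegrable_rpow_mul_add_rpow (N + 1) hA hη).const_mul _),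
    intervalIntegral.integral_const_mul, intervalIntegral.integral_const_mul,
    Real.one_rpow, Real.zero_rpow hA.ne'] at hF
  unfold truncBeta
  linarith

/-- The analytic continuation `Γ(A) Γ(N - A) / Γ(N)` of the Beta integral. -/
noncomputable def betaCont (A N : ℝ) : ℝ := Real.Gamma A * Real.Gamma (N - A) / Real.Gamma N

/-- This is the recursion of `truncBeta` without its boundary term. Hence `truncBeta - η ^ (A - N) *
betaCont` is driven by the boundary term `(1 + η) ^ (-N)` alone. -/
theorem betaCont_succ {A N : ℝ} (hN : 0 < N) (hAN : ∀ z : ℤ, A - N ≠ z) :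
    N * betaCont A (N + 1) = -(A - N) * betaCont A N := by
  have h0 : N - A ≠ 0 := fun h => hAN 0 (by push_cast; linarith)
  unfold betaCont
  rw [show N + 1 - A = (N - A) + 1 by ring, Real.Gamma_add_one h0, Real.Gamma_add_one hN.ne']
  have := (Real.Gamma_pos_of_pos hN).ne'
  field_simp
  ring

/-- For `N > A` the integral over `(0, ∞)` converges to the pure power of `η`, so the difference is
minus the tail over `(1, ∞)`, largest in absolute value at `η = 0`. -/
theorem truncBeta_bound_of_lt {A N : ℝ} (hA : 0 < A) (hN : A < N) :
    ∃ C : ℝ, ∀ η : ℝ, 0 < η → η ≤ 1 →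
      |truncBeta A N η - η ^ (A - N) * betaCont A N| ≤ C := by
  refine ⟨∫ s in Set.Ioi (1 : ℝ), s ^ (A - N - 1), fun η hη _ => ?_⟩
  obtain ⟨h1, h2⟩ := integrableOn_and_integral_rpow_mul_add_rpow hA hN hη
  have hsplit : ∫ s in Set.Ioi (0 : ℝ), s ^ (A - 1) * (s + η) ^ (-N) = truncBeta A N η +
      ∫ s in Set.Ioi (1 : ℝ), s ^ (A - 1) * (s + η) ^ (-N) := by
    rw [truncBeta, intervalIntegral.integral_of_le zero_le_one, ← setIntegral_union
      Set.Ioc_disjoint_Ioi_same measurableSet_Ioi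
      (h1.mono_set Set.Ioc_subset_Ioi_self)
      (h1.mono_set (Set.Ioi_subset_Ioi zero_le_one)), Set.Ioc_union_Ioi_eq_Ioi zero_le_one]
  rw [betaCont, ← h2, hsplit, sub_add_cancel_left, abs_neg, abs_of_nonneg]
  · refine setIntegral_mono_on (h1.mono_set (Set.Ioi_subset_Ioi zero_le_one))
      (integrableOn_Ioi_rpow_of_lt (by linarith) one_pos) measurableSet_Ioi fun s hs => ?_
    have hs : 1 < s := hs
    have hs0 : 0 < s := by linarith
    rw [show A - N - 1 = (A - 1) + -N by ring, Real.rpow_add hs0]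
    refine mul_le_mul_of_nonneg_left ?_ (by positivity)
    exact Real.rpow_le_rpow_of_nonpos hs0 (by linarith) (by linarith)
  · refine setIntegral_nonneg measurableSet_Ioi fun s hs => ?_
    have hs : 1 < s := hs
    have hs0 : 0 < s := by linarith
    positivity

theorem abs_one_add_rpow_neg_sub_one_le {N : ℝ} (hN : 0 < N) :
    ∀ η : ℝ, 0 < η → |(1 + η) ^ (-N) - 1| ≤ N * η := by
  intro η hη
  have h1 : (1 + η) ^ (-N) ≤ 1 := Real.rpow_le_one_of_one_le_of_nonpos (by linarith) (by linarith)
  rw [abs_of_nonpos (by linarith), Real.rpow_def_of_pos (by linarith)]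
  have h2 := Real.log_le_sub_one_of_pos (show 0 < 1 + η by linarith)
  have h3 := Real.add_one_le_exp (Real.log (1 + η) * -N)
  nlinarith

/-- One use of the recursion: the bounded difference at `N + 1` is multiplied by `N η`, and `(1 + η)
^ (-N) = 1 + O(η)` supplies the constant `1 / (A - N)`. -/
theorem truncBeta_expansion_of_succ {A N : ℝ} (hA : 0 < A) (hN : 0 < N)
    (hAN : ∀ z : ℤ, A - N ≠ z)
    (h : ∃ C : ℝ, ∀ η : ℝ, 0 < η → η ≤ 1 →
      |truncBeta A (N + 1) η - η ^ (A - (N + 1)) * betaCont A (N + 1)| ≤ C) :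
    ∃ C : ℝ, ∀ η : ℝ, 0 < η → η ≤ 1 →
      |truncBeta A N η - η ^ (A - N) * betaCont A N - 1 / (A - N)| ≤ C * η := by
  obtain ⟨C, hC⟩ := h
  have h0 : A - N ≠ 0 := fun h => hAN 0 (by push_cast; linarith)
  refine ⟨(N + N * C) / |A - N|, fun η hη h1 => ?_⟩
  have hrec := truncBeta_recursion (N := N) hA hη
  have hb := betaCont_succ hN hAN
  have hpow : η ^ (A - N) = η * η ^ (A - (N + 1)) := by
    rw [show A - N = (A - (N + 1)) + 1 by ring, Real.rpow_add_one hη.ne']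
    ring
  have key : truncBeta A N η - η ^ (A - N) * betaCont A N - 1 / (A - N) =
      (((1 + η) ^ (-N) - 1) -
        N * η * (truncBeta A (N + 1) η - η ^ (A - (N + 1)) * betaCont A (N + 1))) / (A - N) := by
    rw [eq_div_iff h0, sub_mul, sub_mul, one_div_mul_cancel h0, mul_comm (truncBeta A N η), hrec,
      hpow]
    linear_combination (-η * η ^ (A - (N + 1))) * hb
  rw [key, abs_div, div_mul_eq_mul_div]
  refine div_le_div_of_nonneg_right ?_ (abs_nonneg _)
  refine (abs_sub _ _).trans ?_
  rw [abs_mul, abs_of_pos (mul_pos hN hη)]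
  have e1 := abs_one_add_rpow_neg_sub_one_le hN η hη
  have e2 := mul_le_mul_of_nonneg_left (hC η hη h1) (mul_pos hN hη).le
  linarith

theorem truncBeta_bound {A N : ℝ} (hA : 0 < A) (hN : 0 < N) (hAN : ∀ z : ℤ, A - N ≠ z) :
    ∃ C : ℝ, ∀ η : ℝ, 0 < η → η ≤ 1 →
      |truncBeta A N η - η ^ (A - N) * betaCont A N| ≤ C := by
  -- The induction raises `N` until it exceeds `A`, where the integral over the half-line converges;
  -- `n` counts the steps needed.
  obtain ⟨n, hn⟩ := exists_nat_gt (A - N)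
  induction n generalizing N with
  | zero => exact truncBeta_bound_of_lt hA (by push_cast at hn; linarith)
  | succ n ih =>
    have hs := ih (N := N + 1) (by linarith)
      (fun z hz => hAN (z + 1) (by push_cast; linarith)) (by push_cast at hn; linarith)
    obtain ⟨C, hC⟩ := truncBeta_expansion_of_succ hA hN hAN hs
    refine ⟨|C| + |1 / (A - N)|, fun η hη h1 => ?_⟩
    have := hC η hη h1
    have h3 : C * η ≤ |C| := by
      calc C * η ≤ |C| * η := mul_le_mul_of_nonneg_right (le_abs_self C) hη.le
        _ ≤ |C| * 1 := mul_le_mul_of_nonneg_left h1 (abs_nonneg C)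
        _ = |C| := mul_one _
    have h4 := abs_add_le (truncBeta A N η - η ^ (A - N) * betaCont A N - 1 / (A - N))
      (1 / (A - N))
    rw [sub_add_cancel] at h4
    linarith

theorem truncBeta_expansion {A N : ℝ} (hA : 0 < A) (hN : 0 < N) (hAN : ∀ z : ℤ, A - N ≠ z) :
    ∃ C : ℝ, ∀ η : ℝ, 0 < η → η ≤ 1 →
      |truncBeta A N η - η ^ (A - N) * betaCont A N - 1 / (A - N)| ≤ C * η :=
  truncBeta_expansion_of_succ hA hN hAN (truncBeta_bound hA (by linarith)
    fun z hz => hAN (z + 1) (by push_cast; linarith))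

/-! ### The law of a Gamma variable divided by a power-distributed one. -/

theorem intervalIntegrable_rpow_mul_exp {b : ℝ} (hb : 0 < b) (c x y : ℝ) :
    IntervalIntegrable (fun t : ℝ => t ^ (b - 1) * Real.exp (-(t * c))) volume x y :=
  (intervalIntegral.intervalIntegrable_rpow' (by linarith)).mul_continuousOn (by fun_prop)

/-- The lower incomplete Gamma function. -/
noncomputable def lowerGamma (b u : ℝ) : ℝ := ∫ t in (0 : ℝ)..u, t ^ (b - 1) * Real.exp (-(t * 1))

theorem continuous_lowerGamma {b : ℝ} (hb : 0 < b) : Continuous (lowerGamma b) :=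
  intervalIntegral.continuous_primitive (intervalIntegrable_rpow_mul_exp hb 1) 0

theorem hasDerivAt_lowerGamma {b u : ℝ} (hb : 0 < b) (hu : 0 < u) :
    HasDerivAt (lowerGamma b) (u ^ (b - 1) * Real.exp (-u)) u := by
  have hc : ContinuousOn (fun t : ℝ => t ^ (b - 1) * Real.exp (-(t * 1))) (Set.Ioi 0) :=
    ContinuousOn.mul (ContinuousOn.rpow_const continuousOn_id fun x hx => Or.inl (ne_of_gt hx))
      (by fun_prop)
  have := intervalIntegral.integral_hasDerivAt_right (intervalIntegrable_rpow_mul_exp hb 1 0 u)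
    (hc.stronglyMeasurableAtFilter isOpen_Ioi u hu) (hc.continuousAt (Ioi_mem_nhds hu))
  rw [mul_one] at this
  exact this

theorem lowerGamma_nonneg {b u : ℝ} (hu : 0 ≤ u) : 0 ≤ lowerGamma b u :=
  intervalIntegral.integral_nonneg hu fun t ht => by
    have := ht.1
    positivity

theorem lowerGamma_le {b u : ℝ} (hb : 0 < b) (hu : 0 ≤ u) : lowerGamma b u ≤ u ^ b / b := by
  have h : ∫ t in (0 : ℝ)..u, t ^ (b - 1) = u ^ b / b := by
    rw [integral_rpow (Or.inl (by linarith)), sub_add_cancel, Real.zero_rpow hb.ne', sub_zero]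
  rw [← h]
  refine intervalIntegral.integral_mono_on hu (intervalIntegrable_rpow_mul_exp hb 1 0 u)
    (intervalIntegral.intervalIntegrable_rpow' (by linarith)) fun t ht => ?_
  have ht0 := ht.1
  refine mul_le_of_le_one_right (by positivity) (Real.exp_le_one_iff.2 (by linarith))

theorem integral_rpow_mul_exp_eq_lowerGamma {b u : ℝ} (hu : 0 < u) :
    ∫ s in (0 : ℝ)..1, s ^ (b - 1) * Real.exp (-(s * u)) = u ^ (-b) * lowerGamma b u := by
  have h := intervalIntegral.integral_comp_mul_left (a := 0) (b := 1)
    (fun t : ℝ => t ^ (b - 1) * Real.exp (-(t * 1))) hu.ne'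
  rw [mul_zero, mul_one, smul_eq_mul] at h
  have e : ∫ x in (0 : ℝ)..1, (u * x) ^ (b - 1) * Real.exp (-(u * x * 1)) =
      u ^ (b - 1) * ∫ s in (0 : ℝ)..1, s ^ (b - 1) * Real.exp (-(s * u)) := by
    rw [← intervalIntegral.integral_const_mul]
    refine intervalIntegral.integral_congr fun x hx => ?_
    rw [Set.uIcc_of_le zero_le_one] at hx
    rw [Real.mul_rpow hu.le hx.1, mul_one, mul_comm u x]
    ring
  rw [e] at h
  have hp : u ^ (b - 1) ≠ 0 := (Real.rpow_pos_of_pos hu _).ne'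
  rw [← mul_right_inj' hp, h, lowerGamma, Real.rpow_sub_one hu.ne', Real.rpow_neg hu.le]
  have hp' : u ^ b ≠ 0 := (Real.rpow_pos_of_pos hu _).ne'
  field_simp

/-- Density of `X / S`, up to a constant, for `X` Gamma distributed with shape `a` and `S` on
`(0, 1)` with density proportional to `s ^ (Ψ - 1)`. -/
noncomputable def ratioPDF (Ψ a y : ℝ) : ℝ :=
  y ^ (a - 1) * ∫ s in (0 : ℝ)..1, s ^ (Ψ + a - 1) * Real.exp (-(s * y))

/-- The primitive of `ratioPDF` that vanishes at `0`. -/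
noncomputable def ratioCDF (Ψ a u : ℝ) : ℝ := ∫ t in (0 : ℝ)..u, ratioPDF Ψ a t

theorem ratioPDF_eq_lowerGamma {Ψ a y : ℝ} (hy : 0 < y) :
    ratioPDF Ψ a y = y ^ (-Ψ - 1) * lowerGamma (Ψ + a) y := by
  rw [ratioPDF, integral_rpow_mul_exp_eq_lowerGamma hy, ← mul_assoc, ← Real.rpow_add hy]
  ring_nf

theorem ratioPDF_nonneg {Ψ a y : ℝ} (hy : 0 ≤ y) : 0 ≤ ratioPDF Ψ a y :=
  mul_nonneg (by positivity) <| intervalIntegral.integral_nonneg zero_le_one fun s hs => by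
    have := hs.1
    positivity

/-- On differentiating the right side the two `u ^ (a - 1) e ^ (-u)` terms cancel, leaving
`ratioPDF`. It vanishes at `0` because `lowerGamma (Ψ + a) u ≤ u ^ (Ψ + a) / (Ψ + a)` beats `u ^
(-Ψ)`. -/
theorem integrableOn_ratioPDF_and_ratioCDF_eq_lowerGamma {Ψ a u : ℝ} (hΨ : 0 < Ψ) (ha : 0 < a)
    (hu : 0 < u) :
    IntervalIntegrable (ratioPDF Ψ a) volume 0 u ∧
      ratioCDF Ψ a u = (lowerGamma a u - u ^ (-Ψ) * lowerGamma (Ψ + a) u) / Ψ := by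
  set Q : ℝ → ℝ := fun u => (lowerGamma a u - u ^ (-Ψ) * lowerGamma (Ψ + a) u) / Ψ with hQ
  have hΨa : 0 < Ψ + a := by positivity
  have hQ0 : Q 0 = 0 := by
    simp [hQ, lowerGamma]
  have hlim : Tendsto (fun u : ℝ => u ^ (-Ψ) * lowerGamma (Ψ + a) u)
      (nhdsWithin 0 (Set.Ici 0)) (nhds 0) := by
    have h2 : Tendsto (fun u : ℝ => u ^ a / (Ψ + a)) (nhdsWithin 0 (Set.Ici 0)) (nhds 0) := by
      have := ((Real.continuous_rpow_const ha.le).div_const (Ψ + a)).tendsto 0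
      rw [Real.zero_rpow ha.ne', zero_div] at this
      exact this.mono_left nhdsWithin_le_nhds
    refine squeeze_zero' ?_ ?_ h2
    · filter_upwards [self_mem_nhdsWithin] with u hu
      have hu : 0 ≤ u := hu
      have := lowerGamma_nonneg (b := Ψ + a) hu
      positivity
    · filter_upwards [self_mem_nhdsWithin] with u hu
      rcases (show 0 ≤ u from hu).eq_or_lt with rfl | hu
      · simp [lowerGamma, Real.zero_rpow ha.ne']
      · calc u ^ (-Ψ) * lowerGamma (Ψ + a) u ≤ u ^ (-Ψ) * (u ^ (Ψ + a) / (Ψ + a)) :=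
            mul_le_mul_of_nonneg_left (lowerGamma_le hΨa hu.le) (by positivity)
          _ = u ^ a / (Ψ + a) := by
            rw [← mul_div_assoc, ← Real.rpow_add hu]
            ring_nf
  have hcont : ContinuousOn Q (Set.Icc 0 u) := by
    refine ContinuousOn.div_const (ContinuousOn.sub (continuous_lowerGamma ha).continuousOn ?_) _
    intro x hx
    rcases hx.1.eq_or_lt with rfl | hx0
    · have : ContinuousWithinAt (fun u : ℝ => u ^ (-Ψ) * lowerGamma (Ψ + a) u) (Set.Ici 0) 0 := by
        unfold ContinuousWithinAt
        convert hlim using 2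
        simp [lowerGamma]
      exact this.mono Set.Icc_subset_Ici_self
    · exact ((Real.continuousAt_rpow_const x _ (Or.inl hx0.ne')).mul
        (continuous_lowerGamma hΨa).continuousAt).continuousWithinAt
  have hderiv : ∀ x ∈ Set.Ioo 0 u, HasDerivAt Q (ratioPDF Ψ a x) x := by
    intro x hx
    have hx0 : 0 < x := hx.1
    have h := ((hasDerivAt_lowerGamma ha hx0).sub ((Real.hasDerivAt_rpow_const (p := -Ψ)
      (Or.inl hx0.ne')).mul (hasDerivAt_lowerGamma hΨa hx0))).div_const Ψ
    refine h.congr_deriv ?_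
    rw [ratioPDF_eq_lowerGamma hx0, show x ^ (a - 1) = x ^ (-Ψ) * x ^ (Ψ + a - 1) by
      rw [← Real.rpow_add hx0]; ring_nf]
    field_simp
    ring
  -- A nonnegative derivative of a function continuous up to the endpoints is integrable, so no
  -- estimate of `ratioPDF` near `0` is needed.
  have hint : IntervalIntegrable (ratioPDF Ψ a) volume 0 u := by
    rw [intervalIntegrable_iff_integrableOn_Ioc_of_le hu.le]
    exact intervalIntegral.integrableOn_deriv_of_nonneg hcont hderiv
      fun x hx => ratioPDF_nonneg hx.1.le
  refine ⟨hint, ?_⟩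
  rw [ratioCDF, intervalIntegral.integral_eq_sub_of_hasDerivAt_of_le hu.le hcont hderiv hint, hQ0,
    sub_zero]

/-- The mixing weight of `ratioCDF` as a mixture of exponentials. -/
noncomputable def ratioWeight (Ψ a w : ℝ) : ℝ := (w ^ (a - 1) - w ^ (Ψ + a - 1)) / Ψ

theorem ratioWeight_nonneg {Ψ a w : ℝ} (hΨ : 0 < Ψ) (hw : 0 < w) (hw1 : w ≤ 1) :
    0 ≤ ratioWeight Ψ a w :=
  div_nonneg (sub_nonneg.2 (Real.rpow_le_rpow_of_exponent_ge hw hw1 (by linarith))) hΨ.le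

theorem measurable_ratioWeight (Ψ a : ℝ) : Measurable (ratioWeight Ψ a) := by
  unfold ratioWeight
  fun_prop

theorem ratioWeight_mul_rpow {Ψ a w : ℝ} (e : ℝ) (hw : 0 < w) :
    ratioWeight Ψ a w * w ^ e = (w ^ (a + e - 1) - w ^ (Ψ + a + e - 1)) / Ψ := by
  rw [ratioWeight, div_mul_eq_mul_div, sub_mul, ← Real.rpow_add hw, ← Real.rpow_add hw]
  ring_nf

/-- Meant for `e = Ψ' - a`, `e = 0` and `e = 1`: the singular power, the constant and the error in
the expansion of `truncBeta`. -/
theorem integrableOn_and_integral_ratioWeight_mul_rpow {Ψ a e : ℝ} (hΨ : 0 < Ψ) (he : 0 < a + e) :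
    IntegrableOn (fun w => ratioWeight Ψ a w * w ^ e) (Set.Ioc 0 1) ∧
      ∫ w in Set.Ioc (0 : ℝ) 1, ratioWeight Ψ a w * w ^ e = 1 / ((a + e) * (Ψ + a + e)) := by
  have h1 : IntervalIntegrable (fun w : ℝ => w ^ (a + e - 1)) volume 0 1 :=
    intervalIntegral.intervalIntegrable_rpow' (by linarith)
  have h2 : IntervalIntegrable (fun w : ℝ => w ^ (Ψ + a + e - 1)) volume 0 1 :=
    intervalIntegral.intervalIntegrable_rpow' (by linarith)
  have hc : Set.EqOn (fun w => ratioWeight Ψ a w * w ^ e)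
      (fun w => (w ^ (a + e - 1) - w ^ (Ψ + a + e - 1)) / Ψ) (Set.Ioc 0 1) :=
    fun w hw => ratioWeight_mul_rpow e hw.1
  constructor
  · rw [integrableOn_congr_fun hc measurableSet_Ioc,
      ← intervalIntegrable_iff_integrableOn_Ioc_of_le zero_le_one]
    exact (h1.sub h2).div_const Ψ
  · rw [setIntegral_congr_fun measurableSet_Ioc hc, ← intervalIntegral.integral_of_le zero_le_one,
      intervalIntegral.integral_div, intervalIntegral.integral_sub h1 h2,
      integral_rpow (Or.inl (by linarith)), integral_rpow (Or.inl (by linarith)),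
      sub_add_cancel, sub_add_cancel, Real.zero_rpow he.ne', Real.zero_rpow (show Ψ + a + e ≠ 0 by linarith),
      Real.one_rpow, Real.one_rpow]
    have : Ψ + a + e ≠ 0 := by linarith
    field_simp
    ring

/-- Both incomplete Gamma functions are rescaled to `(0, 1)`. In this form `δ` enters only through
the factor `δ ^ a` and the rates of the exponentials. -/
theorem ratioCDF_eq_integral_exp {Ψ a u : ℝ} (hΨ : 0 < Ψ) (ha : 0 < a) (hu : 0 < u) :
    ratioCDF Ψ a u = u ^ a *
      ∫ w in Set.Ioc (0 : ℝ) 1, ratioWeight Ψ a w * Real.exp (-(w * u)) := by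
  rw [(integrableOn_ratioPDF_and_ratioCDF_eq_lowerGamma hΨ ha hu).2,
    ← intervalIntegral.integral_of_le zero_le_one]
  have : ∀ w : ℝ, ratioWeight Ψ a w * Real.exp (-(w * u)) =
      (w ^ (a - 1) * Real.exp (-(w * u)) - w ^ (Ψ + a - 1) * Real.exp (-(w * u))) / Ψ := fun w => by
    rw [ratioWeight]
    ring
  simp_rw [this]
  rw [intervalIntegral.integral_div, intervalIntegral.integral_sub
    (intervalIntegrable_rpow_mul_exp ha u 0 1)
    (intervalIntegrable_rpow_mul_exp (by positivity) u 0 1),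
    integral_rpow_mul_exp_eq_lowerGamma hu, integral_rpow_mul_exp_eq_lowerGamma hu,
    ← mul_div_assoc, mul_sub, ← mul_assoc, ← mul_assoc, ← Real.rpow_add hu, ← Real.rpow_add hu,
    add_neg_cancel, Real.rpow_zero, one_mul]
  ring_nf

/-! ### The integral of `ratioCDF` against `ratioPDF` and its expansion at small `δ`. -/

theorem measurable_integral_rpow_mul_exp (A : ℝ) :
    Measurable fun y : ℝ => ∫ s in Set.Ioc (0 : ℝ) 1, s ^ (A - 1) * Real.exp (-(s * y)) := by
  have : Measurable (fun p : ℝ × ℝ => p.2 ^ (A - 1) * Real.exp (-(p.2 * p.1))) := by fun_prop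
  exact (this.stronglyMeasurable.integral_prod_right'
    (ν := volume.restrict (Set.Ioc (0 : ℝ) 1))).measurable

theorem measurable_truncBeta (A N : ℝ) : Measurable (truncBeta A N) := by
  have : Measurable (fun p : ℝ × ℝ => p.2 ^ (A - 1) * (p.2 + p.1) ^ (-N)) := by fun_prop
  have := (this.stronglyMeasurable.integral_prod_right'
    (ν := volume.restrict (Set.Ioc (0 : ℝ) 1))).measurable
  have h : truncBeta A N = fun η => ∫ s in Set.Ioc (0 : ℝ) 1, s ^ (A - 1) * (s + η) ^ (-N) := by
    funext η
    rw [truncBeta, intervalIntegral.integral_of_le zero_le_one]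
  rw [h]
  exact this

theorem integrableOn_and_integral_rpow_mul_exp_mul_laplace {A N c : ℝ} (hA : 0 < A) (hN : 0 < N)
    (hc : 0 < c) :
    IntegrableOn (fun y : ℝ => y ^ (N - 1) * Real.exp (-(c * y)) *
        ∫ s in Set.Ioc (0 : ℝ) 1, s ^ (A - 1) * Real.exp (-(s * y))) (Set.Ioi 0) ∧
      ∫ y in Set.Ioi (0 : ℝ), (y ^ (N - 1) * Real.exp (-(c * y)) *
        ∫ s in Set.Ioc (0 : ℝ) 1, s ^ (A - 1) * Real.exp (-(s * y))) =
      Real.Gamma N * truncBeta A N c := by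
  have hsplit : ∀ s y : ℝ, y ^ (N - 1) * Real.exp (-(c * y)) *
      (s ^ (A - 1) * Real.exp (-(s * y))) =
      s ^ (A - 1) * (y ^ (N - 1) * Real.exp (-((s + c) * y))) := fun s y => by
    rw [show -((s + c) * y) = -(c * y) + -(s * y) by ring, Real.exp_add]
    ring
  have key := integrable_and_integral_integral_eq_of_nonneg
    (μ := volume.restrict (Set.Ioi (0 : ℝ))) (ν := volume.restrict (Set.Ioc (0 : ℝ) 1))
    (f := fun y s => y ^ (N - 1) * Real.exp (-(c * y)) * (s ^ (A - 1) * Real.exp (-(s * y))))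
    (h := fun s => Real.Gamma N * (s ^ (A - 1) * (s + c) ^ (-N)))
    (by
      refine Measurable.aestronglyMeasurable ?_
      unfold Function.uncurry
      fun_prop)
    (by
      filter_upwards [ae_restrict_mem measurableSet_Ioc] with s hs
      filter_upwards [ae_restrict_mem measurableSet_Ioi] with y hy
      have hs : 0 < s := hs.1
      have hy : 0 < y := hy
      positivity)
    (by
      filter_upwards [ae_restrict_mem measurableSet_Ioc] with s hs
      have hs : 0 < s := hs.1
      simp_rw [hsplit]
      exact (integrableOn_rpow_mul_exp_neg_mul hN (by positivity)).const_mul _)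
    (by
      filter_upwards [ae_restrict_mem measurableSet_Ioc] with s hs
      have hs : 0 < s + c := add_pos hs.1 hc
      simp_rw [hsplit]
      rw [integral_const_mul, Real.integral_rpow_mul_exp_neg_mul_Ioi hN hs, one_div,
        Real.inv_rpow hs.le, ← Real.rpow_neg hs.le]
      ring)
    (((intervalIntegrable_iff_integrableOn_Ioc_of_le zero_le_one).1
      (intervalIntegrable_rpow_mul_add_rpow N hA hc)).const_mul _)
  simp_rw [integral_const_mul] at key
  refine ⟨key.1, key.2.trans ?_⟩
  rw [truncBeta, intervalIntegral.integral_of_le zero_le_one]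

/-- Dominated by a constant plus a multiple of `w ^ (A - N)`, both integrable against the weight; `a
+ (A - N) > 0` is what the second one requires. -/
theorem integrableOn_ratioWeight_mul_truncBeta {Ψ a A N δ : ℝ} (hΨ : 0 < Ψ) (ha : 0 < a)
    (hA : 0 < A) (hN : 0 < N) (haA : 0 < a + (A - N)) (hAN : ∀ z : ℤ, A - N ≠ z)
    (hδ : 0 < δ) (hδ1 : δ ≤ 1) :
    IntegrableOn (fun w => ratioWeight Ψ a w * truncBeta A N (w * δ)) (Set.Ioc 0 1) := by
  obtain ⟨C, hC⟩ := truncBeta_bound hA hN hAN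
  have i1 := (integrableOn_and_integral_ratioWeight_mul_rpow (Ψ := Ψ) (a := a) (e := 0) hΨ
    (by linarith)).1.const_mul C
  have i2 := (integrableOn_and_integral_ratioWeight_mul_rpow (Ψ := Ψ) (a := a) (e := A - N) hΨ
    haA).1.const_mul (δ ^ (A - N) * |betaCont A N|)
  refine (i1.add i2).mono' ?_ ?_
  · exact ((measurable_ratioWeight Ψ a).mul ((measurable_truncBeta A N).comp
      (measurable_id.mul_const δ))).aestronglyMeasurable
  · filter_upwards [ae_restrict_mem measurableSet_Ioc] with w hw
    have hw0 : 0 < w := hw.1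
    have hm := ratioWeight_nonneg (a := a) hΨ hw.1 hw.2
    have hwδ : 0 < w * δ := by positivity
    have hb := hC (w * δ) hwδ (mul_le_one₀ hw.2 hδ.le hδ1)
    have hT := truncBeta_nonneg (A := A) (N := N) hwδ
    have : truncBeta A N (w * δ) ≤ C + (w * δ) ^ (A - N) * |betaCont A N| := by
      have h1 := (abs_le.1 hb).2
      have h2 : (w * δ) ^ (A - N) * betaCont A N ≤ (w * δ) ^ (A - N) * |betaCont A N| :=
        mul_le_mul_of_nonneg_left (le_abs_self _) (by positivity)
      linarith
    rw [Real.norm_of_nonneg (by positivity)]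
    refine (mul_le_mul_of_nonneg_left this hm).trans (le_of_eq ?_)
    simp only [Pi.add_apply]
    rw [Real.mul_rpow hw0.le hδ.le, Real.rpow_zero]
    ring

/-- For fixed `w` the `y`-integral pairs `y ^ (a + a' - 1) e ^ (-w δ y)` with the Laplace integral
inside `ratioPDF`, which gives `Γ(a + a')` times a truncated Beta integral at `η = w δ`. -/
theorem integrableOn_and_integral_ratioCDF_mul_ratioPDF {Ψ a Ψ' a' δ : ℝ} (hΨ : 0 < Ψ)
    (ha : 0 < a) (hΨ' : 0 < Ψ') (ha' : 0 < a') (hres : ∀ z : ℤ, Ψ' - a ≠ z)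
    (hδ : 0 < δ) (hδ1 : δ ≤ 1) :
    IntegrableOn (fun y => ratioCDF Ψ a (δ * y) * ratioPDF Ψ' a' y) (Set.Ioi 0) ∧
      ∫ y in Set.Ioi (0 : ℝ), ratioCDF Ψ a (δ * y) * ratioPDF Ψ' a' y =
        Real.Gamma (a + a') * δ ^ a * ∫ w in Set.Ioc (0 : ℝ) 1,
          ratioWeight Ψ a w * truncBeta (Ψ' + a') (a + a') (w * δ) := by
  have hA : 0 < Ψ' + a' := by positivity
  have hN : 0 < a + a' := by positivity
  have hcon := fun w (hw : 0 < w) => integrableOn_and_integral_rpow_mul_exp_mul_laplace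
    (c := w * δ) hA hN (mul_pos hw hδ)
  have key := integrable_and_integral_integral_eq_of_nonneg
    (μ := volume.restrict (Set.Ioi (0 : ℝ))) (ν := volume.restrict (Set.Ioc (0 : ℝ) 1))
    (f := fun y w => δ ^ a * ratioWeight Ψ a w * (y ^ (a + a' - 1) * Real.exp (-(w * δ * y)) *
      ∫ s in Set.Ioc (0 : ℝ) 1, s ^ (Ψ' + a' - 1) * Real.exp (-(s * y))))
    (h := fun w => Real.Gamma (a + a') * δ ^ a *
      (ratioWeight Ψ a w * truncBeta (Ψ' + a') (a + a') (w * δ)))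
    (by
      refine Measurable.aestronglyMeasurable ?_
      have h1 := measurable_integral_rpow_mul_exp (Ψ' + a')
      have h2 := measurable_ratioWeight Ψ a
      unfold Function.uncurry
      refine Measurable.mul ((h2.comp measurable_snd).const_mul _)
        (Measurable.mul (by fun_prop) (h1.comp measurable_fst)))
    (by
      filter_upwards [ae_restrict_mem measurableSet_Ioc] with w hw
      filter_upwards [ae_restrict_mem measurableSet_Ioi] with y hy
      have hw0 : 0 < w := hw.1
      have hy : 0 < y := hy
      have := ratioWeight_nonneg (a := a) hΨ hw.1 hw.2
      have h3 : 0 ≤ ∫ s in Set.Ioc (0 : ℝ) 1, s ^ (Ψ' + a' - 1) * Real.exp (-(s * y)) :=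
        setIntegral_nonneg measurableSet_Ioc fun s hs => by
          have := hs.1
          positivity
      positivity)
    (by
      filter_upwards [ae_restrict_mem measurableSet_Ioc] with w hw
      exact (hcon w hw.1).1.const_mul _)
    (by
      filter_upwards [ae_restrict_mem measurableSet_Ioc] with w hw
      rw [integral_const_mul, (hcon w hw.1).2]
      ring)
    ((integrableOn_ratioWeight_mul_truncBeta hΨ ha hA hN (by linarith)
      (by simpa [show Ψ' + a' - (a + a') = Ψ' - a by ring] using hres) hδ hδ1).const_mul _)
  have hcongr : Set.EqOn (fun y => ∫ w in Set.Ioc (0 : ℝ) 1, δ ^ a * ratioWeight Ψ a w *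
      (y ^ (a + a' - 1) * Real.exp (-(w * δ * y)) *
        ∫ s in Set.Ioc (0 : ℝ) 1, s ^ (Ψ' + a' - 1) * Real.exp (-(s * y))))
      (fun y => ratioCDF Ψ a (δ * y) * ratioPDF Ψ' a' y) (Set.Ioi 0) := by
    intro y hy
    have hy : 0 < y := hy
    simp only
    rw [ratioCDF_eq_integral_exp hΨ ha (mul_pos hδ hy), ratioPDF,
      intervalIntegral.integral_of_le zero_le_one, ← integral_const_mul, ← integral_mul_const]
    refine integral_congr_ae (ae_of_all _ fun w => ?_)
    simp only
    rw [Real.mul_rpow hδ.le hy.le, show a + a' - 1 = a + (a' - 1) by ring, Real.rpow_add hy,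
      mul_assoc w]
    ring
  refine ⟨(integrableOn_congr_fun hcongr measurableSet_Ioi).1 key.1, ?_⟩
  rw [← setIntegral_congr_fun measurableSet_Ioi hcongr, key.2, integral_const_mul]

/-- The two leading terms of `∫ y, ratioCDF Ψ a (δ * y) * ratioPDF Ψ' a' y` at small `δ`. -/
noncomputable def ratioMain (Ψ a Ψ' a' δ : ℝ) : ℝ :=
  Real.Gamma (Ψ' + a') * Real.Gamma (a - Ψ') / (Ψ' * (Ψ + Ψ')) * δ ^ Ψ' +
    Real.Gamma (a + a') / ((Ψ' - a) * (a * (Ψ + a))) * δ ^ a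

/-- Since `w δ ≤ 1` on the whole range of `w`, the expansion of `truncBeta` holds uniformly and
integrates term by term against `ratioWeight`. Non-integrality of `Ψ' - a` keeps the powers `δ ^ Ψ'`
and `δ ^ (a + n)` apart, so no logarithm appears. -/
theorem integral_ratioCDF_mul_ratioPDF_expansion {Ψ a Ψ' a' : ℝ} (hΨ : 0 < Ψ)
    (ha : 0 < a) (hΨ' : 0 < Ψ') (ha' : 0 < a') (hres : ∀ z : ℤ, Ψ' - a ≠ z) :
    ∃ C : ℝ, ∀ δ : ℝ, 0 < δ → δ ≤ 1 →
      |(∫ y in Set.Ioi (0 : ℝ), ratioCDF Ψ a (δ * y) * ratioPDF Ψ' a' y) -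
        ratioMain Ψ a Ψ' a' δ| ≤ C * δ ^ (a + 1) := by
  have hA : 0 < Ψ' + a' := by positivity
  have hN : 0 < a + a' := by positivity
  have hΓ : 0 < Real.Gamma (a + a') := Real.Gamma_pos_of_pos hN
  have hs : Ψ' + a' - (a + a') = Ψ' - a := by ring
  have hAN : ∀ z : ℤ, Ψ' + a' - (a + a') ≠ z := by rwa [hs]
  have h0 : Ψ' - a ≠ 0 := fun h => hres 0 (by simpa using h)
  obtain ⟨C, hC⟩ := truncBeta_expansion hA hN hAN
  rw [hs] at hC
  obtain ⟨i0, e0⟩ := integrableOn_and_integral_ratioWeight_mul_rpow (Ψ := Ψ) (a := a) (e := 0) hΨ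
    (by linarith)
  obtain ⟨i1, e1⟩ := integrableOn_and_integral_ratioWeight_mul_rpow (Ψ := Ψ) (a := a) (e := 1) hΨ
    (by linarith)
  obtain ⟨i2, e2⟩ := integrableOn_and_integral_ratioWeight_mul_rpow (Ψ := Ψ) (a := a)
    (e := Ψ' - a) hΨ (by linarith)
  refine ⟨Real.Gamma (a + a') * (C * (1 / ((a + 1) * (Ψ + a + 1)))), fun δ hδ hδ1 => ?_⟩
  rw [(integrableOn_and_integral_ratioCDF_mul_ratioPDF hΨ ha hΨ' ha' hres hδ hδ1).2]
  have iT := integrableOn_ratioWeight_mul_truncBeta hΨ ha hA hN (by linarith) hAN hδ hδ1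
  set T := truncBeta (Ψ' + a') (a + a')
  set b := betaCont (Ψ' + a') (a + a') with hb
  have hdiff : |(∫ w in Set.Ioc (0 : ℝ) 1, ratioWeight Ψ a w * T (w * δ)) -
      (δ ^ (Ψ' - a) * b * (1 / ((a + (Ψ' - a)) * (Ψ + a + (Ψ' - a)))) +
        1 / (Ψ' - a) * (1 / ((a + 0) * (Ψ + a + 0))))| ≤
      C * δ * (1 / ((a + 1) * (Ψ + a + 1))) := by
    have iS : IntegrableOn (fun w => δ ^ (Ψ' - a) * b * (ratioWeight Ψ a w * w ^ (Ψ' - a)) +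
        1 / (Ψ' - a) * (ratioWeight Ψ a w * w ^ (0 : ℝ))) (Set.Ioc 0 1) :=
      (i2.const_mul _).add (i0.const_mul _)
    rw [← e0, ← e1, ← e2, ← integral_const_mul, ← integral_const_mul, ← integral_const_mul,
      ← integral_add (i2.const_mul _) (i0.const_mul _),
      ← integral_sub iT iS]
    refine (abs_integral_le_integral_abs).trans ?_
    refine setIntegral_mono_on (iT.sub iS).abs
      (i1.const_mul _) measurableSet_Ioc fun w hw => ?_
    have hw0 : 0 < w := hw.1
    have hm := ratioWeight_nonneg (a := a) hΨ hw.1 hw.2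
    have hwδ : 0 < w * δ := by positivity
    have := hC (w * δ) hwδ (mul_le_one₀ hw.2 hδ.le hδ1)
    have e : ratioWeight Ψ a w * T (w * δ) - (δ ^ (Ψ' - a) * b * (ratioWeight Ψ a w * w ^ (Ψ' - a))
        + 1 / (Ψ' - a) * (ratioWeight Ψ a w * w ^ (0 : ℝ))) =
        ratioWeight Ψ a w * (T (w * δ) - (w * δ) ^ (Ψ' - a) * b - 1 / (Ψ' - a)) := by
      rw [Real.mul_rpow hw0.le hδ.le, Real.rpow_zero]
      ring
    rw [e, abs_mul, abs_of_nonneg hm, Real.rpow_one]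
    refine (mul_le_mul_of_nonneg_left this hm).trans (le_of_eq ?_)
    ring
  have hmain : ratioMain Ψ a Ψ' a' δ = Real.Gamma (a + a') * δ ^ a *
      (δ ^ (Ψ' - a) * b * (1 / ((a + (Ψ' - a)) * (Ψ + a + (Ψ' - a)))) +
        1 / (Ψ' - a) * (1 / ((a + 0) * (Ψ + a + 0)))) := by
    rw [ratioMain, hb, betaCont, show a + a' - (Ψ' + a') = a - Ψ' by ring,
      show δ ^ Ψ' = δ ^ a * δ ^ (Ψ' - a) by rw [← Real.rpow_add hδ]; ring_nf,
      show a + (Ψ' - a) = Ψ' by ring, show Ψ + a + (Ψ' - a) = Ψ + Ψ' by ring, add_zero, add_zero]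
    field_simp
  rw [hmain, ← mul_sub, abs_mul, abs_of_pos (by positivity), Real.rpow_add_one hδ.ne']
  refine (mul_le_mul_of_nonneg_left hdiff (by positivity)).trans (le_of_eq ?_)
  ring

/-! ### The RF SNR as a finite combination of ratio laws. -/

theorem integral_rpow_mul_comp_rpow {α D : ℝ} (β : ℝ) (hα : 0 < α) (hD : 0 < D) (h : ℝ → ℝ) :
    ∫ q in (0 : ℝ)..D, q ^ β * h (q ^ α) =
      D ^ (β + 1) / α * ∫ s in (0 : ℝ)..1, s ^ ((β + 1) / α - 1) * h (D ^ α * s) := by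
  have hDα : 0 < D ^ α := Real.rpow_pos_of_pos hD α
  have h1 : ∫ q in (0 : ℝ)..D, q ^ β * h (q ^ α) =
      1 / α * ∫ s in (0 : ℝ)..(D ^ α), s ^ ((β + 1) / α - 1) * h s := by
    rw [intervalIntegral.integral_of_le hD.le, intervalIntegral.integral_of_le hDα.le]
    -- The power substitution is made on the whole half-line; the indicator carries the cutoff `q ≤
    -- D` to `s ≤ D ^ α`.
    have := integral_comp_rpow_Ioi_of_pos
      (g := (Set.Ioc 0 (D ^ α)).indicator fun s => s ^ ((β + 1) / α - 1) * h s) hα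
    rw [setIntegral_indicator measurableSet_Ioc, Set.inter_eq_self_of_subset_right
      Set.Ioc_subset_Ioi_self] at this
    rw [← this, ← integral_const_mul, ← integral_indicator measurableSet_Ioc,
      ← integral_indicator measurableSet_Ioi]
    congr 1
    funext q
    by_cases hq : 0 < q
    · rw [Set.indicator_of_mem (s := Set.Ioi 0) hq]
      by_cases hqD : q ≤ D
      · rw [Set.indicator_of_mem (s := Set.Ioc 0 D) ⟨hq, hqD⟩, Set.indicator_of_mem
          (s := Set.Ioc 0 (D ^ α)) ⟨Real.rpow_pos_of_pos hq α, Real.rpow_le_rpow hq.le hqD hα.le⟩, smul_eq_mul,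
          ← Real.rpow_mul hq.le]
        have : q ^ β = q ^ (α - 1) * q ^ (α * ((β + 1) / α - 1)) := by
          rw [← Real.rpow_add hq]
          congr 1
          field_simp
          ring
        rw [this]
        field_simp
      · rw [Set.indicator_of_notMem (s := Set.Ioc 0 D) (fun hh => hqD hh.2),
          Set.indicator_of_notMem (s := Set.Ioc 0 (D ^ α)) (fun hh => hqD ((Real.rpow_le_rpow_iff hq.le hD.le hα).1 hh.2)), smul_zero, mul_zero]
    · rw [Set.indicator_of_notMem (s := Set.Ioc 0 D) (fun hh => hq hh.1),
        Set.indicator_of_notMem (s := Set.Ioi 0) (fun hh => hq hh)]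
  have h2 := intervalIntegral.integral_comp_mul_left (a := 0) (b := 1)
    (fun s : ℝ => s ^ ((β + 1) / α - 1) * h s) hDα.ne'
  have h3 : ∫ s in (0 : ℝ)..1, (D ^ α * s) ^ ((β + 1) / α - 1) * h (D ^ α * s) =
      (D ^ α) ^ ((β + 1) / α - 1) * ∫ s in (0 : ℝ)..1, s ^ ((β + 1) / α - 1) * h (D ^ α * s) := by
    rw [← intervalIntegral.integral_const_mul]
    refine intervalIntegral.integral_congr fun s hs => ?_
    rw [Set.uIcc_of_le zero_le_one] at hs
    rw [Real.mul_rpow hDα.le hs.1]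
    ring
  rw [h3, mul_zero, mul_one, smul_eq_mul] at h2
  have h4 : D ^ (β + 1) = D ^ α * (D ^ α) ^ ((β + 1) / α - 1) := by
    rw [← Real.rpow_mul hD.le, ← Real.rpow_add hD]
    congr 1
    field_simp
    ring
  rw [eq_inv_mul_iff_mul_eq₀ hDα.ne'] at h2
  rw [h1, h4, ← h2]
  ring

theorem intervalIntegrable_and_integral_sum_sum {ι κ : Type*} (s : Finset ι) (t : Finset κ)
    {f : ι → κ → ℝ → ℝ} {a b : ℝ} (hf : ∀ i k, IntervalIntegrable (f i k) volume a b) :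
    IntervalIntegrable (fun x => ∑ i ∈ s, ∑ k ∈ t, f i k x) volume a b ∧
      ∫ x in a..b, ∑ i ∈ s, ∑ k ∈ t, f i k x = ∑ i ∈ s, ∑ k ∈ t, ∫ x in a..b, f i k x := by
  have h1 : ∀ i, IntervalIntegrable (fun x => ∑ k ∈ t, f i k x) volume a b := fun i => by
    have := IntervalIntegrable.sum t fun k _ => hf i k
    rwa [Finset.sum_fn] at this
  constructor
  · have := IntervalIntegrable.sum s fun i _ => h1 i
    rwa [Finset.sum_fn] at this
  · rw [intervalIntegral.integral_finsetSum fun i _ => h1 i]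
    exact Finset.sum_congr rfl fun i _ =>
      intervalIntegral.integral_finsetSum fun k _ => hf i k

theorem besselV_pos {k p : ℕ} {v : ℝ} (hp : 1 ≤ p) (hk : k ≤ p) (hv : -1 < v) :
    0 < besselV k p v := by
  have hp' : (1 : ℝ) ≤ p := by exact_mod_cast hp
  have hk' : (k : ℝ) ≤ p := by exact_mod_cast hk
  have hk0 : (0 : ℝ) ≤ k := Nat.cast_nonneg k
  have h1 : 0 < Real.Gamma ((p : ℝ) + k) := Real.Gamma_pos_of_pos (by linarith)
  have h2 : 0 < Real.Gamma ((k : ℝ) + 1) := Real.Gamma_pos_of_pos (by linarith)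
  have h3 : 0 < Real.Gamma ((p : ℝ) - k + 1) := Real.Gamma_pos_of_pos (by linarith)
  have h4 : 0 < Real.Gamma (v + k + 1) := Real.Gamma_pos_of_pos (by linarith)
  have h5 : (0 : ℝ) < p := by linarith
  unfold besselV
  positivity

/-- The prefactor gives `w ^ ((m - 1) / 2)` and the `k`-th Bessel term `w ^ ((m - 1) / 2 + k)`.
Together they form an unnormalized Gamma density of shape `m + k`. -/
theorem kappaMuPowerPDF_eq_sum {κ m w : ℝ} (p : ℕ) (hκ : 0 < κ) (hm : 0 < m) (hw : 0 < w) :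
    kappaMuPowerPDF p κ m w = ∑ k ∈ Finset.range (p + 1),
      besselV k p (m - 1) * (m * κ) ^ k / Real.exp (m * κ) * (m * (1 + κ)) ^ (m + k) *
        w ^ (m + k - 1) * Real.exp (-(m * (1 + κ)) * w) := by
  rw [kappaMuPowerPDF, besselIApprox, Finset.mul_sum]
  refine Finset.sum_congr rfl fun k _ => ?_
  have h1 : 0 < 1 + κ := by linarith
  obtain ⟨c, hc⟩ : ∃ c, (m - 1) / 2 = c := ⟨_, rfl⟩
  have hm' : m = 2 * c + 1 := by linarith
  have e1 : (2 * m * √(κ * (1 + κ)) * √w / 2) ^ (m - 1 + 2 * (k : ℝ)) =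
      m ^ (m - 1 + 2 * (k : ℝ)) * κ ^ (c + k) * (1 + κ) ^ (c + k) * w ^ (c + k) := by
    rw [show 2 * m * √(κ * (1 + κ)) * √w / 2 = m * √(κ * (1 + κ) * w) by
      rw [Real.sqrt_mul (by positivity) w]; ring, Real.mul_rpow hm.le (Real.sqrt_nonneg _),
      Real.sqrt_eq_rpow, ← Real.rpow_mul (by positivity),
      show 1 / 2 * (m - 1 + 2 * (k : ℝ)) = c + k by rw [hm']; ring,
      Real.mul_rpow (by positivity) hw.le, Real.mul_rpow hκ.le h1.le]
    ring
  have e2 : m * m ^ (m - 1 + 2 * (k : ℝ)) = m ^ (m + k) * m ^ k := by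
    rw [← Real.rpow_natCast m k, ← Real.rpow_add hm, mul_comm, ← Real.rpow_add_one hm.ne']
    ring_nf
  have e3 : (1 + κ) ^ ((m + 1) / 2) * (1 + κ) ^ (c + k) = (1 + κ) ^ (m + k) := by
    rw [← Real.rpow_add h1]
    congr 1
    rw [hm']
    ring
  have e4 : w ^ c * w ^ (c + k) = w ^ (m + k - 1) := by
    rw [← Real.rpow_add hw]
    congr 1
    rw [hm']
    ring
  have e5 : κ ^ (c + (k : ℝ)) = κ ^ c * κ ^ k := by
    rw [Real.rpow_add hκ, Real.rpow_natCast]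
  have hκc : κ ^ c ≠ 0 := (Real.rpow_pos_of_pos hκ c).ne'
  have hexp := (Real.exp_pos (m * κ)).ne'
  rw [hc, e1, e5, Real.mul_rpow hm.le h1.le, ← e3, ← e4, mul_pow]
  field_simp
  linear_combination (besselV k p (m - 1)) * e2

namespace RFLink

variable (j : RFLink)

theorem L_mul_μ_pos : 0 < j.L * j.μ :=
  mul_pos (Nat.cast_pos.2 j.L_pos) j.μ_pos

theorem Ψ_pos (i : Fin 3) : 0 < j.Ψ i := by
  have := j.α_pos
  unfold Ψ
  fin_cases i <;> simp [rwpBeta] <;> positivity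

theorem B_pos : 0 < j.B := by
  have := j.L_mul_μ_pos
  have := j.κ_pos
  unfold B μMRC
  positivity

theorem K₂_pos {γ : ℝ} (hγ : 0 < γ) : 0 < j.K₂ γ := by
  have := j.B_pos
  have := j.D_pos
  have := j.ϱ_pos
  have : (0 : ℝ) < j.L := Nat.cast_pos.2 j.L_pos
  unfold K₂
  positivity

/-- Substituting `s = (q / D) ^ α` makes the distance weight `q ^ β` proportional to `s ^ (Ψ - 1)`,
the law of the denominator behind `ratioPDF`. -/
theorem integral_rwp_term {a b : ℝ} (i : Fin 3) (ha : 0 < a) (hb : 0 < b) {x : ℝ} (hx : 0 < x) :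
    IntervalIntegrable (fun q : ℝ => rwpC i / j.D ^ (rwpBeta i + 1) * q ^ rwpBeta i *
      (b ^ a * x ^ (a - 1) * (q ^ j.α) ^ a * Real.exp (-(b * x * q ^ j.α)))) volume 0 j.D ∧
    ∫ q in (0 : ℝ)..j.D, rwpC i / j.D ^ (rwpBeta i + 1) * q ^ rwpBeta i *
      (b ^ a * x ^ (a - 1) * (q ^ j.α) ^ a * Real.exp (-(b * x * q ^ j.α))) =
      rwpC i / j.α * (b * j.D ^ j.α * ratioPDF (j.Ψ i) a (b * j.D ^ j.α * x)) := by
  have hD := j.D_pos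
  have hα := j.α_pos
  have hβ : 0 ≤ rwpBeta i := by fin_cases i <;> simp [rwpBeta]
  constructor
  · refine Continuous.intervalIntegrable ?_ _ _
    have h1 : Continuous fun q : ℝ => q ^ j.α := Real.continuous_rpow_const hα.le
    have h2 : Continuous fun q : ℝ => q ^ rwpBeta i := Real.continuous_rpow_const hβ
    have h3 : Continuous fun q : ℝ => (q ^ j.α) ^ a :=
      (Real.continuous_rpow_const ha.le).comp h1
    fun_prop
  · have hDα : 0 < j.D ^ j.α := Real.rpow_pos_of_pos hD _
    have hK : 0 < b * j.D ^ j.α := by positivity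
    have := integral_rpow_mul_comp_rpow (rwpBeta i) hα hD
      (fun z => b ^ a * x ^ (a - 1) * z ^ a * Real.exp (-(b * x * z)))
    simp_rw [mul_assoc (rwpC i / j.D ^ (rwpBeta i + 1))]
    rw [intervalIntegral.integral_const_mul, this, ratioPDF]
    have e : ∫ s in (0 : ℝ)..1, s ^ ((rwpBeta i + 1) / j.α - 1) *
        (b ^ a * x ^ (a - 1) * (j.D ^ j.α * s) ^ a * Real.exp (-(b * x * (j.D ^ j.α * s)))) =
        b ^ a * x ^ (a - 1) * (j.D ^ j.α) ^ a * ∫ s in (0 : ℝ)..1,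
          s ^ (j.Ψ i + a - 1) * Real.exp (-(s * (b * j.D ^ j.α * x))) := by
      rw [← intervalIntegral.integral_const_mul, intervalIntegral.integral_of_le zero_le_one,
        intervalIntegral.integral_of_le zero_le_one]
      refine setIntegral_congr_fun measurableSet_Ioc fun s hs => ?_
      have hs : 0 < s := hs.1
      rw [Real.mul_rpow hDα.le hs.le, show j.Ψ i + a - 1 = ((rwpBeta i + 1) / j.α - 1) + a by
        rw [Ψ]; ring, Real.rpow_add hs, show b * x * (j.D ^ j.α * s) = s * (b * j.D ^ j.α * x) by
        ring]
      ring
    rw [e, Real.mul_rpow hK.le hx.le, Real.rpow_sub_one hK.ne', Real.mul_rpow hb.le hDα.le]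
    have hDβ : j.D ^ (rwpBeta i + 1) ≠ 0 := (Real.rpow_pos_of_pos hD _).ne'
    generalize ∫ s in (0 : ℝ)..1, s ^ (j.Ψ i + a - 1) * Real.exp (-(s * (b * j.D ^ j.α * x))) = I
    field_simp

theorem intervalIntegrable_and_snrPDF_eq_sum (p : ℕ) {γ x : ℝ} (hγ : 0 < γ) (hx : 0 < x) :
    IntervalIntegrable (fun q => rwpPDF j.D q * (q ^ j.α / (j.ϱ * (j.L * γ)) *
      kappaMuPowerPDF p j.κ j.μMRC (x * (q ^ j.α / (j.ϱ * (j.L * γ)))))) volume 0 j.D ∧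
    j.snrPDF p γ x = ∑ i : Fin 3, ∑ k ∈ Finset.range (p + 1),
      j.K₁ p i k * (j.K₂ γ * ratioPDF (j.Ψ i) (j.L * j.μ + k) (j.K₂ γ * x)) := by
  have hL : (0 : ℝ) < j.L := Nat.cast_pos.2 j.L_pos
  have hϱ := j.ϱ_pos
  have hB := j.B_pos
  have hm := j.L_mul_μ_pos
  have hα := j.α_pos
  have hc : 0 < j.ϱ * (j.L * γ) := by positivity
  set b : ℝ := j.B / (j.ϱ * (j.L * γ)) with hb
  have hb0 : 0 < b := by positivity
  have hK₂ : j.K₂ γ = b * j.D ^ j.α := by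
    rw [K₂, hb, mul_assoc j.ϱ]
    ring
  have hint : ∀ q ∈ Set.Ioc 0 j.D, rwpPDF j.D q * (q ^ j.α / (j.ϱ * (j.L * γ)) *
      kappaMuPowerPDF p j.κ j.μMRC (x * (q ^ j.α / (j.ϱ * (j.L * γ))))) =
      ∑ i : Fin 3, ∑ k ∈ Finset.range (p + 1),
        besselV k p (j.L * j.μ - 1) * (j.L * j.μ * j.κ) ^ k / Real.exp (j.L * j.μ * j.κ) *
        (rwpC i / j.D ^ (rwpBeta i + 1) * q ^ rwpBeta i * (b ^ (j.L * j.μ + k) *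
          x ^ (j.L * j.μ + k - 1) * (q ^ j.α) ^ (j.L * j.μ + k) *
          Real.exp (-(b * x * q ^ j.α)))) := by
    intro q hq
    have hz : 0 < q ^ j.α := Real.rpow_pos_of_pos hq.1 _
    rw [kappaMuPowerPDF_eq_sum p j.κ_pos (m := j.μMRC) hm (by positivity), rwpPDF, Finset.sum_mul]
    refine Finset.sum_congr rfl fun i _ => ?_
    rw [Finset.mul_sum, Finset.mul_sum]
    refine Finset.sum_congr rfl fun k _ => ?_
    have hBe : j.μMRC * (1 + j.κ) = j.B := rfl
    have hBb : j.B = b * (j.ϱ * (j.L * γ)) := by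
      rw [hb]
      field_simp
    have e1 : (j.B) ^ (j.μMRC + k) * (x * (q ^ j.α / (j.ϱ * (j.L * γ)))) ^ (j.μMRC + k - 1) *
        (q ^ j.α / (j.ϱ * (j.L * γ))) =
        b ^ (j.L * j.μ + k) * x ^ (j.L * j.μ + k - 1) * (q ^ j.α) ^ (j.L * j.μ + k) := by
      rw [hBb, Real.mul_rpow hb0.le hc.le, Real.mul_rpow hx.le (by positivity),
        Real.div_rpow hz.le hc.le, Real.rpow_sub_one hc.ne', Real.rpow_sub_one hz.ne', μMRC]
      have := (Real.rpow_pos_of_pos hc (j.L * j.μ + k)).ne'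
      field_simp
    have e2 : -(j.B) * (x * (q ^ j.α / (j.ϱ * (j.L * γ)))) = -(b * x * q ^ j.α) := by
      rw [hb]
      ring
    rw [hBe, e2, ← e1, μMRC]
    ring
  have hi := fun (i : Fin 3) (k : ℕ) => j.integral_rwp_term (a := j.L * j.μ + k) i
    (by positivity) hb0 hx
  obtain ⟨hs, hs'⟩ := intervalIntegrable_and_integral_sum_sum Finset.univ (Finset.range (p + 1))
    fun i k => (hi i k).1.const_mul (besselV k p (j.L * j.μ - 1) * (j.L * j.μ * j.κ) ^ k /
      Real.exp (j.L * j.μ * j.κ))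
  constructor
  · rw [intervalIntegrable_iff_integrableOn_Ioc_of_le j.D_pos.le] at hs ⊢
    exact (integrableOn_congr_fun hint measurableSet_Ioc).2 hs
  · rw [snrPDF, intervalIntegral.integral_of_le j.D_pos.le,
      setIntegral_congr_fun measurableSet_Ioc hint, ← intervalIntegral.integral_of_le j.D_pos.le,
      hs']
    refine Finset.sum_congr rfl fun i _ => Finset.sum_congr rfl fun k _ => ?_
    rw [intervalIntegral.integral_const_mul, (hi i k).2, hK₂, K₁]
    have := (Real.exp_pos (j.L * j.μ * j.κ)).ne'
    field_simp

theorem snrPDF_eq_sum (p : ℕ) {γ x : ℝ} (hγ : 0 < γ) (hx : 0 < x) :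
    j.snrPDF p γ x = ∑ i : Fin 3, ∑ k ∈ Finset.range (p + 1),
      j.K₁ p i k * (j.K₂ γ * ratioPDF (j.Ψ i) (j.L * j.μ + k) (j.K₂ γ * x)) :=
  (j.intervalIntegrable_and_snrPDF_eq_sum p hγ hx).2

end RFLink

namespace RFLink

variable (j : RFLink)

theorem intervalIntegrable_snrPDF_and_snrCDF_eq_sum (p : ℕ) {γ x : ℝ} (hγ : 0 < γ) (hx : 0 < x) :
    IntervalIntegrable (j.snrPDF p γ) volume 0 x ∧
      j.snrCDF p γ x = ∑ i : Fin 3, ∑ k ∈ Finset.range (p + 1),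
        j.K₁ p i k * ratioCDF (j.Ψ i) (j.L * j.μ + k) (j.K₂ γ * x) := by
  have hm := j.L_mul_μ_pos
  have hK := j.K₂_pos hγ
  have hi : ∀ (i : Fin 3) (k : ℕ), IntervalIntegrable (fun t => j.K₁ p i k *
      (j.K₂ γ * ratioPDF (j.Ψ i) (j.L * j.μ + k) (j.K₂ γ * t))) volume 0 x := fun i k => by
    have := (integrableOn_ratioPDF_and_ratioCDF_eq_lowerGamma (a := j.L * j.μ + k) (j.Ψ_pos i)
      (by positivity) (mul_pos hK hx)).1.comp_mul_left (c := j.K₂ γ)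
    rw [zero_div, mul_div_cancel_left₀ _ hK.ne'] at this
    exact (this.const_mul _).const_mul _
  obtain ⟨h1, h2⟩ := intervalIntegrable_and_integral_sum_sum Finset.univ (Finset.range (p + 1)) hi
  have hc : Set.EqOn (j.snrPDF p γ) (fun t => ∑ i : Fin 3, ∑ k ∈ Finset.range (p + 1),
      j.K₁ p i k * (j.K₂ γ * ratioPDF (j.Ψ i) (j.L * j.μ + k) (j.K₂ γ * t))) (Set.Ioc 0 x) :=
    fun t ht => j.snrPDF_eq_sum p hγ ht.1
  constructor
  · rw [intervalIntegrable_iff_integrableOn_Ioc_of_le hx.le] at h1 ⊢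
    exact (integrableOn_congr_fun hc measurableSet_Ioc).2 h1
  · rw [snrCDF, intervalIntegral.integral_of_le hx.le, setIntegral_congr_fun measurableSet_Ioc hc,
      ← intervalIntegral.integral_of_le hx.le, h2]
    refine Finset.sum_congr rfl fun i _ => Finset.sum_congr rfl fun k _ => ?_
    rw [intervalIntegral.integral_const_mul, intervalIntegral.integral_const_mul,
      intervalIntegral.integral_comp_mul_left _ hK.ne', mul_zero, smul_eq_mul,
      mul_inv_cancel_left₀ hK.ne', ratioCDF]

end RFLink

/-- `∫ y, ratioCDF Ψ a (δ * y) * ratioPDF Ψ' a' y` over `(0, ∞)`. -/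
noncomputable def ratioIntegral (Ψ a Ψ' a' δ : ℝ) : ℝ :=
  ∫ y in Set.Ioi (0 : ℝ), ratioCDF Ψ a (δ * y) * ratioPDF Ψ' a' y

/-! ### The RF outage integral and the two residues of `SOP₁Inf`. -/

theorem integrableOn_and_integral_rf (p : ℕ) {φ : ℝ} (hφ : 0 < φ) (R E : RFLink)
    (hres : ∀ (i : Fin 3) (z : ℤ), E.Ψ i - R.L * R.μ ≠ z) {γR γE : ℝ} (hγR : 0 < γR)
    (hγE : 0 < γE) (hδ1 : φ * R.K₂ γR / E.K₂ γE ≤ 1) :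
    IntegrableOn (fun x => R.snrCDF p γR (φ * x) * E.snrPDF p γE x) (Set.Ioi 0) ∧
      ∫ x in Set.Ioi (0 : ℝ), R.snrCDF p γR (φ * x) * E.snrPDF p γE x =
        ∑ iR : Fin 3, ∑ kR ∈ Finset.range (p + 1), ∑ iE : Fin 3, ∑ kE ∈ Finset.range (p + 1),
          R.K₁ p iR kR * E.K₁ p iE kE * ratioIntegral (R.Ψ iR) (R.L * R.μ + kR) (E.Ψ iE)
            (E.L * E.μ + kE) (φ * R.K₂ γR / E.K₂ γE) := by
  have hKR := R.K₂_pos hγR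
  have hKE := E.K₂_pos hγE
  have hmR := R.L_mul_μ_pos
  have hmE := E.L_mul_μ_pos
  set δ := φ * R.K₂ γR / E.K₂ γE with hδ
  have hδ0 : 0 < δ := by positivity
  set g : Fin 3 → ℕ → Fin 3 → ℕ → ℝ → ℝ := fun iR kR iE kE y =>
    ratioCDF (R.Ψ iR) (R.L * R.μ + kR) (δ * y) * ratioPDF (E.Ψ iE) (E.L * E.μ + kE) y with hg
  -- The shape is `L_R μ_R + kR`; the integer shift by `kR` does not affect non-integrality.
  have hgI : ∀ iR kR iE kE, IntegrableOn (g iR kR iE kE) (Set.Ioi 0) := fun iR kR iE kE =>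
    (integrableOn_and_integral_ratioCDF_mul_ratioPDF (R.Ψ_pos iR) (by positivity) (E.Ψ_pos iE)
      (by positivity) (fun z hz => hres iE (z + kR) (by push_cast; linarith)) hδ0 hδ1).1
  set G : Fin 3 → ℕ → Fin 3 → ℕ → ℝ → ℝ := fun iR kR iE kE x =>
    R.K₁ p iR kR * E.K₁ p iE kE * (E.K₂ γE * g iR kR iE kE (E.K₂ γE * x)) with hG
  have hGI : ∀ iR kR iE kE, IntegrableOn (G iR kR iE kE) (Set.Ioi 0) := fun iR kR iE kE => by
    refine Integrable.const_mul (Integrable.const_mul ?_ _) _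
    have := (integrableOn_Ioi_comp_mul_left_iff (g iR kR iE kE) 0 hKE).2
      (by rw [mul_zero]; exact hgI iR kR iE kE)
    exact this
  have hc : Set.EqOn (fun x => R.snrCDF p γR (φ * x) * E.snrPDF p γE x)
      (fun x => ∑ iR : Fin 3, ∑ kR ∈ Finset.range (p + 1), ∑ iE : Fin 3,
        ∑ kE ∈ Finset.range (p + 1), G iR kR iE kE x) (Set.Ioi 0) := by
    intro x hx
    have hx : 0 < x := hx
    simp only
    rw [(R.intervalIntegrable_snrPDF_and_snrCDF_eq_sum p hγR (mul_pos hφ hx)).2,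
      E.snrPDF_eq_sum p hγE hx, Finset.sum_mul]
    refine Finset.sum_congr rfl fun iR _ => ?_
    rw [Finset.sum_mul]
    refine Finset.sum_congr rfl fun kR _ => ?_
    rw [Finset.mul_sum]
    refine Finset.sum_congr rfl fun iE _ => ?_
    rw [Finset.mul_sum]
    refine Finset.sum_congr rfl fun kE _ => ?_
    rw [hG, hg]
    simp only
    rw [show δ * (E.K₂ γE * x) = R.K₂ γR * (φ * x) by rw [hδ]; field_simp]
    ring
  have i3 := fun iR kR iE => integrable_finsetSum (Finset.range (p + 1))
    fun kE _ => hGI iR kR iE kE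
  have i2 := fun iR kR => integrable_finsetSum Finset.univ fun iE _ => i3 iR kR iE
  have i1 := fun iR => integrable_finsetSum (Finset.range (p + 1)) fun kR _ => i2 iR kR
  have i0 := integrable_finsetSum Finset.univ fun iR _ => i1 iR
  refine ⟨(integrableOn_congr_fun hc measurableSet_Ioi).2 i0, ?_⟩
  rw [setIntegral_congr_fun measurableSet_Ioi hc, integral_finsetSum _ fun iR _ => i1 iR]
  refine Finset.sum_congr rfl fun iR _ => ?_
  rw [integral_finsetSum _ fun kR _ => i2 iR kR]
  refine Finset.sum_congr rfl fun kR _ => ?_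
  rw [integral_finsetSum _ fun iE _ => i3 iR kR iE]
  refine Finset.sum_congr rfl fun iE _ => ?_
  rw [integral_finsetSum _ fun kE _ => hGI iR kR iE kE]
  refine Finset.sum_congr rfl fun kE _ => ?_
  rw [integral_const_mul, integral_const_mul, integral_comp_mul_left_Ioi _ _ hKE, mul_zero,
    smul_eq_mul, mul_inv_cancel_left₀ hKE.ne', ratioIntegral]

/-- In both residues most Gamma factors pair up as `Γ(z) / Γ(z + 1) = 1 / z`. The residue at `1 -
Ψ_E` becomes the `δ ^ Ψ'` term of `ratioMain`, the one at `1 - L_R μ_R - k_R` the `δ ^ a` term. -/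
theorem one_sub_SOP₁Inf_eq (p : ℕ) {φ : ℝ} (hφ : 0 < φ) (R E : RFLink)
    (hres : ∀ (i : Fin 3) (z : ℤ), E.Ψ i - R.L * R.μ ≠ z) {γR γE : ℝ} (hγR : 0 < γR)
    (hγE : 0 < γE) :
    1 - SOP₁Inf p φ R E γR γE =
        ∑ iR : Fin 3, ∑ kR ∈ Finset.range (p + 1), ∑ iE : Fin 3, ∑ kE ∈ Finset.range (p + 1),
          R.K₁ p iR kR * E.K₁ p iE kE * ratioMain (R.Ψ iR) (R.L * R.μ + kR) (E.Ψ iE)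
            (E.L * E.μ + kE) (φ * R.K₂ γR / E.K₂ γE) := by
  have hKR := R.K₂_pos hγR
  have hKE := E.K₂_pos hγE
  rw [SOP₁Inf, sub_sub_cancel]
  refine Finset.sum_congr rfl fun iR _ => Finset.sum_congr rfl fun kR _ => ?_
  rw [Finset.mul_sum]
  refine Finset.sum_congr rfl fun iE _ => ?_
  rw [Finset.mul_sum]
  refine Finset.sum_congr rfl fun kE _ => ?_
  rw [mul_assoc]
  congr 2
  have hδ : E.K₂ γE / (φ * R.K₂ γR) = (φ * R.K₂ γR / E.K₂ γE)⁻¹ := (inv_div _ _).symm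
  have hδ0 : 0 < φ * R.K₂ γR / E.K₂ γE := by positivity
  rw [hδ]
  generalize φ * R.K₂ γR / E.K₂ γE = δ at hδ0
  have ha : 0 < R.L * R.μ + kR := add_pos_of_pos_of_nonneg R.L_mul_μ_pos (Nat.cast_nonneg _)
  have hΨR := R.Ψ_pos iR
  have hΨE := E.Ψ_pos iE
  have ha' := E.L_mul_μ_pos
  have h0 : E.Ψ iE - (R.L * R.μ + kR) ≠ 0 := fun h => hres iE kR (by push_cast; linarith)
  have h34 : Finset.Icc 3 4 = {3, 4} := rfl
  have e1 : (Finset.Icc 1 2).erase 1 = {2} := rfl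
  have e2 : (Finset.Icc 1 2).erase 2 = {1} := rfl
  have h13 : ∀ f : ℕ → ℝ, ∏ l ∈ Finset.Icc 1 3, f l = f 1 * (f 2 * f 3) := fun f => by
    rw [show Finset.Icc 1 3 = {1, 2, 3} from rfl, Finset.prod_insert (by simp),
      Finset.prod_pair (by norm_num)]
  rw [show Finset.Icc 1 2 = {1, 2} from rfl, Finset.sum_pair (by norm_num),
    ← show Finset.Icc 1 2 = {1, 2} from rfl, e1, e2, h34, Finset.prod_singleton,
    Finset.prod_singleton, h13, h13, Finset.prod_pair (by norm_num), Finset.prod_pair (by norm_num)]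
  simp only [T₆, T₇]
  obtain ⟨a, haa⟩ : ∃ a, R.L * R.μ + (kR : ℝ) = a := ⟨_, rfl⟩
  obtain ⟨a', haa'⟩ : ∃ a', E.L * E.μ + (kE : ℝ) = a' := ⟨_, rfl⟩
  rw [show (1 : ℝ) - R.L * R.μ - kR = 1 - a by rw [← haa]; ring, haa, haa']
  rw [haa] at ha h0
  generalize R.Ψ iR = Ψ at *
  generalize hΨ' : E.Ψ iE = Ψ' at *
  rw [show 1 - Ψ' - 1 = -Ψ' by ring, show 1 - a - 1 = -a by ring,
    show 1 - Ψ' - (1 - a) = a - Ψ' by ring, show 1 + a' - (1 - Ψ') = Ψ' + a' by ring,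
    show 1 + Ψ - (1 - Ψ') = Ψ + Ψ' by ring, show 1 + 0 - (1 - Ψ') = Ψ' by ring,
    show 1 + 1 - (1 - Ψ') = Ψ' + 1 by ring, show 1 + (1 + Ψ) - (1 - Ψ') = Ψ + Ψ' + 1 by ring,
    show 1 - Ψ' + Ψ' = 1 by ring, show 1 - a - (1 - Ψ') = Ψ' - a by ring,
    show 1 + a' - (1 - a) = a + a' by ring, show 1 + Ψ - (1 - a) = Ψ + a by ring,
    show 1 + 0 - (1 - a) = a by ring, show 1 + 1 - (1 - a) = a + 1 by ring,
    show 1 + (1 + Ψ) - (1 - a) = Ψ + a + 1 by ring, show 1 - a + Ψ' = Ψ' - a + 1 by ring,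
    Real.Gamma_one, Real.Gamma_add_one hΨE.ne', Real.Gamma_add_one (by positivity),
    Real.Gamma_add_one ha.ne', Real.Gamma_add_one (by positivity), Real.Gamma_add_one h0,
    Real.inv_rpow hδ0.le, Real.inv_rpow hδ0.le, ← Real.rpow_neg hδ0.le, ← Real.rpow_neg hδ0.le,
    neg_neg, neg_neg, ratioMain]
  have g1 := (Real.Gamma_pos_of_pos hΨE).ne'
  have g2 := (Real.Gamma_pos_of_pos ha).ne'
  have g3 := (Real.Gamma_pos_of_pos (add_pos hΨR hΨE)).ne'
  have g4 := (Real.Gamma_pos_of_pos (add_pos hΨR ha)).ne'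
  -- `Ψ' - a` may be negative, so only non-integrality allows this factor to be cancelled.
  have g5 : Real.Gamma (Ψ' - a) ≠ 0 := Real.Gamma_ne_zero fun n h =>
    hres iE (kR - n) (by push_cast; linarith)
  field_simp

/-! ### Positivity and lower bounds for the RF densities. -/

/-- The factorization shows positivity on `(0, D)`, which the negative coefficient `-1190 / 72`
hides. -/
theorem rwpPDF_eq {D q : ℝ} (hD : 0 < D) :
    rwpPDF D q = 35 / 72 * q ^ 2 * (D ^ 2 - q ^ 2) * (21 * D ^ 2 - 13 * q ^ 2) / D ^ 7 := by
  have e2 : ∀ x : ℝ, x ^ (2 : ℝ) = x ^ 2 := fun x => by exact_mod_cast Real.rpow_natCast x 2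
  have e4 : ∀ x : ℝ, x ^ (4 : ℝ) = x ^ 4 := fun x => by exact_mod_cast Real.rpow_natCast x 4
  have e6 : ∀ x : ℝ, x ^ (6 : ℝ) = x ^ 6 := fun x => by exact_mod_cast Real.rpow_natCast x 6
  simp only [rwpPDF, Fin.sum_univ_three, rwpC, rwpBeta, Matrix.cons_val]
  rw [Real.rpow_add_one hD.ne', Real.rpow_add_one hD.ne', Real.rpow_add_one hD.ne']
  simp only [e2, e4, e6]
  field_simp
  ring

theorem rwpPDF_pos {D q : ℝ} (hD : 0 < D) (hq : 0 < q) (hqD : q < D) : 0 < rwpPDF D q := by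
  rw [rwpPDF_eq hD]
  have h1 : 0 < D ^ 2 - q ^ 2 := by nlinarith
  have h2 : 0 < 21 * D ^ 2 - 13 * q ^ 2 := by nlinarith
  positivity

theorem le_kappaMuPowerPDF {κ m w : ℝ} {p : ℕ} (hp : 1 ≤ p) (hκ : 0 < κ) (hm : 0 < m)
    (hw : 0 < w) :
    besselV 0 p (m - 1) / Real.exp (m * κ) * (m * (1 + κ)) ^ m * w ^ (m - 1) *
      Real.exp (-(m * (1 + κ)) * w) ≤ kappaMuPowerPDF p κ m w := by
  rw [kappaMuPowerPDF_eq_sum p hκ hm hw]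
  refine le_trans (le_of_eq ?_) (Finset.single_le_sum (f := fun k : ℕ =>
    besselV k p (m - 1) * (m * κ) ^ k / Real.exp (m * κ) * (m * (1 + κ)) ^ (m + k) *
        w ^ (m + k - 1) * Real.exp (-(m * (1 + κ)) * w)) (fun k hk => ?_)
    (Finset.mem_range.2 (Nat.succ_pos p)))
  · simp
  · have := besselV_pos hp (Nat.lt_succ_iff.1 (Finset.mem_range.1 hk))
      (show -1 < m - 1 by linarith)
    positivity

namespace RFLink

variable (j : RFLink)

/-- The `k = 0` term of the fading density already has the order `γ ^ (-L μ)`, and the other terms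
are nonnegative. Working under the distance integral keeps everything positive, unlike the signed
sum over `i`. -/
theorem exists_le_snrPDF {p : ℕ} (hp : 1 ≤ p) {γ₀ T : ℝ} (hγ₀ : 0 < γ₀) (hT : 0 < T) :
    ∃ c : ℝ, 0 < c ∧ ∀ γ, γ₀ ≤ γ → ∀ t, 0 < t → t ≤ T →
      c * γ ^ (-(j.L * j.μ)) * t ^ (j.L * j.μ - 1) ≤ j.snrPDF p γ t := by
  obtain ⟨m, hmm⟩ : ∃ m, j.L * j.μ = m := ⟨_, rfl⟩
  have hm := j.L_mul_μ_pos
  have hL : (0 : ℝ) < j.L := Nat.cast_pos.2 j.L_pos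
  have hϱ := j.ϱ_pos
  have hB := j.B_pos
  have hα := j.α_pos
  have hD := j.D_pos
  have hV := besselV_pos hp (Nat.zero_le p) (show -1 < j.L * j.μ - 1 by linarith)
  have hDα : 0 < j.D ^ j.α := Real.rpow_pos_of_pos hD _
  rw [hmm] at hm hV ⊢
  have hcont : Continuous fun q : ℝ => rwpPDF j.D q * (q ^ j.α) ^ m := by
    have h1 : Continuous fun q : ℝ => q ^ j.α := Real.continuous_rpow_const hα.le
    have h3 : Continuous fun q : ℝ => (q ^ j.α) ^ m :=
      (Real.continuous_rpow_const hm.le).comp h1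
    simp_rw [rwpPDF_eq hD]
    fun_prop
  have hI : 0 < ∫ q in (0 : ℝ)..j.D, rwpPDF j.D q * (q ^ j.α) ^ m := by
    refine intervalIntegral.intervalIntegral_pos_of_pos_on (hcont.intervalIntegrable _ _)
      (fun q hq => ?_) hD
    have := rwpPDF_pos hD hq.1 hq.2
    have := hq.1
    positivity
  -- The exponential is frozen at `q = D`, `t = T`, `γ = γ₀`, a lower bound for it on the whole
  -- range, so `A` does not depend on `γ`.
  set A : ℝ := besselV 0 p (m - 1) / Real.exp (m * j.κ) * j.B ^ m *
    Real.exp (-(j.B * (T * (j.D ^ j.α / (j.ϱ * (j.L * γ₀)))))) * (j.ϱ * j.L) ^ (-m) with hA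
  refine ⟨A * ∫ q in (0 : ℝ)..j.D, rwpPDF j.D q * (q ^ j.α) ^ m, by positivity,
    fun γ hγ t ht htT => ?_⟩
  have hγ0 : 0 < γ := hγ₀.trans_le hγ
  rw [show A * (∫ q in (0 : ℝ)..j.D, rwpPDF j.D q * (q ^ j.α) ^ m) * γ ^ (-m) * t ^ (m - 1) =
      ∫ q in (0 : ℝ)..j.D, A * γ ^ (-m) * t ^ (m - 1) * (rwpPDF j.D q * (q ^ j.α) ^ m) by
    rw [intervalIntegral.integral_const_mul]; ring, snrPDF]
  refine intervalIntegral.integral_mono_on_of_le_Ioo hD.le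
    ((hcont.intervalIntegrable _ _).const_mul _)
    (j.intervalIntegrable_and_snrPDF_eq_sum p hγ0 ht).1 fun q hq => ?_
  have hq0 : 0 < q := hq.1
  have hz : 0 < q ^ j.α := Real.rpow_pos_of_pos hq0 _
  have hc : 0 < j.ϱ * (j.L * γ) := by positivity
  have hs : 0 < q ^ j.α / (j.ϱ * (j.L * γ)) := by positivity
  have hw := rwpPDF_pos hD hq0 hq.2
  have hle := le_kappaMuPowerPDF hp j.κ_pos (show 0 < j.μMRC from j.L_mul_μ_pos)
    (mul_pos ht hs)
  have hexp : Real.exp (-(j.B * (T * (j.D ^ j.α / (j.ϱ * (j.L * γ₀)))))) ≤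
      Real.exp (-j.B * (t * (q ^ j.α / (j.ϱ * (j.L * γ))))) := by
    rw [Real.exp_le_exp, neg_mul, neg_le_neg_iff]
    have := Real.rpow_le_rpow hq0.le hq.2.le hα.le
    gcongr
  have hpow : A * γ ^ (-m) * t ^ (m - 1) * (rwpPDF j.D q * (q ^ j.α) ^ m) =
      rwpPDF j.D q * (q ^ j.α / (j.ϱ * (j.L * γ)) * (besselV 0 p (m - 1) / Real.exp (m * j.κ) *
        j.B ^ m * (t * (q ^ j.α / (j.ϱ * (j.L * γ)))) ^ (m - 1) *
        Real.exp (-(j.B * (T * (j.D ^ j.α / (j.ϱ * (j.L * γ₀)))))))) := by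
    rw [hA, Real.mul_rpow ht.le hs.le, Real.rpow_sub_one hs.ne', Real.div_rpow hz.le hc.le,
      show (j.ϱ * (j.L * γ)) ^ m = (j.ϱ * j.L) ^ m * γ ^ m by
        rw [← mul_assoc, Real.mul_rpow (by positivity) hγ0.le], Real.rpow_neg (by positivity),
      Real.rpow_neg hγ0.le]
    field_simp
  rw [hpow]
  have hμ : j.μMRC = m := hmm
  rw [hμ] at hle ⊢
  have hBe : m * (1 + j.κ) = j.B := by rw [← hμ, B]
  rw [hBe] at hle
  gcongr
  exact le_trans (by gcongr) hle

theorem snrPDF_pos {p : ℕ} (hp : 1 ≤ p) {γ t : ℝ} (hγ : 0 < γ) (ht : 0 < t) :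
    0 < j.snrPDF p γ t := by
  obtain ⟨c, hc, h⟩ := j.exists_le_snrPDF hp hγ ht
  refine lt_of_lt_of_le ?_ (h γ le_rfl t ht le_rfl)
  positivity

theorem exists_le_snrCDF {p : ℕ} (hp : 1 ≤ p) {γ₀ T : ℝ} (hγ₀ : 0 < γ₀) (hT : 0 < T) :
    ∃ c : ℝ, 0 < c ∧ ∀ γ, γ₀ ≤ γ → ∀ t, 0 < t → t ≤ T →
      c * γ ^ (-(j.L * j.μ)) * t ^ (j.L * j.μ) ≤ j.snrCDF p γ t := by
  obtain ⟨c, hc, h⟩ := j.exists_le_snrPDF hp hγ₀ hT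
  have hm := j.L_mul_μ_pos
  refine ⟨c / (j.L * j.μ), by positivity, fun γ hγ t ht htT => ?_⟩
  have e : ∫ s in (0 : ℝ)..t, c * γ ^ (-(j.L * j.μ)) * s ^ (j.L * j.μ - 1) =
      c / (j.L * j.μ) * γ ^ (-(j.L * j.μ)) * t ^ (j.L * j.μ) := by
    rw [intervalIntegral.integral_const_mul, integral_rpow (Or.inl (by linarith)),
      sub_add_cancel, Real.zero_rpow hm.ne']
    ring
  rw [← e, snrCDF]
  refine intervalIntegral.integral_mono_on_of_le_Ioo ht.le
    ((intervalIntegral.intervalIntegrable_rpow' (by linarith)).const_mul _)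
    (j.intervalIntegrable_snrPDF_and_snrCDF_eq_sum p (hγ₀.trans_le hγ) ht).1
    fun s hs => h γ hγ s hs.1 (hs.2.le.trans htT)

theorem snrCDF_nonneg {p : ℕ} (hp : 1 ≤ p) {γ t : ℝ} (hγ : 0 < γ) (ht : 0 < t) :
    0 ≤ j.snrCDF p γ t := by
  obtain ⟨c, hc, h⟩ := j.exists_le_snrCDF hp hγ ht
  refine le_trans ?_ (h γ le_rfl t ht le_rfl)
  positivity

end RFLink

/-! ### Asymptotics of `SOP₁`. -/

theorem exists_K₂_ratio_eq_div {φ : ℝ} (hφ : 0 < φ) (R E : RFLink) {γE : ℝ} (hγE : 0 < γE) :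
    ∃ d : ℝ, 0 < d ∧ ∀ γR, φ * R.K₂ γR / E.K₂ γE = d / γR := by
  have h1 := R.K₂_pos one_pos
  have h2 := E.K₂_pos hγE
  refine ⟨φ * R.K₂ 1 / E.K₂ γE, by positivity, fun γR => ?_⟩
  simp only [RFLink.K₂]
  ring

theorem eventually_div_le_one (d : ℝ) : ∀ᶠ γ : ℝ in atTop, d / γ ≤ 1 := by
  filter_upwards [eventually_ge_atTop d, eventually_gt_atTop 0] with γ h1 h2
  exact (div_le_one h2).2 h1

/-- The integrand is nonnegative, so restricting to `0 < x ≤ 1`, where the power lower bounds hold,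
loses only a constant. -/
theorem one_sub_SOP₁_lower_bound {p : ℕ} (hp : 1 ≤ p) {φ : ℝ} (hφ : 0 < φ) (R E : RFLink)
    (hres : ∀ (i : Fin 3) (z : ℤ), E.Ψ i - R.L * R.μ ≠ z) {γE : ℝ} (hγE : 0 < γE) :
    ∃ c : ℝ, 0 < c ∧ ∀ᶠ γR in atTop, c * γR ^ (-(R.L * R.μ)) ≤ 1 - SOP₁ p φ R E γR γE := by
  obtain ⟨d, hd, hdE⟩ := exists_K₂_ratio_eq_div hφ R E hγE
  obtain ⟨c, hc, hR⟩ := R.exists_le_snrCDF hp one_pos hφ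
  obtain ⟨c', hc', hE⟩ := E.exists_le_snrPDF hp hγE one_pos
  have hm := R.L_mul_μ_pos
  have hm' := E.L_mul_μ_pos
  have hi : IntervalIntegrable (fun x : ℝ => x ^ (R.L * R.μ + E.L * E.μ - 1)) volume 0 1 :=
    intervalIntegral.intervalIntegrable_rpow' (by linarith)
  have hI : ∫ x in Set.Ioc (0 : ℝ) 1, x ^ (R.L * R.μ + E.L * E.μ - 1) =
      1 / (R.L * R.μ + E.L * E.μ) := by
    rw [← intervalIntegral.integral_of_le zero_le_one, integral_rpow (Or.inl (by linarith)),
      sub_add_cancel, Real.one_rpow, Real.zero_rpow (by positivity), sub_zero]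
  refine ⟨c * φ ^ (R.L * R.μ) * (c' * γE ^ (-(E.L * E.μ))) * (1 / (R.L * R.μ + E.L * E.μ)),
    by positivity, ?_⟩
  filter_upwards [eventually_div_le_one d, eventually_ge_atTop 1] with γR h1 h2
  have hγR : 0 < γR := by linarith
  obtain ⟨hint, -⟩ := integrableOn_and_integral_rf p hφ R E hres hγR hγE (by rwa [hdE])
  rw [SOP₁, sub_sub_cancel]
  calc c * φ ^ (R.L * R.μ) * (c' * γE ^ (-(E.L * E.μ))) * (1 / (R.L * R.μ + E.L * E.μ)) *
        γR ^ (-(R.L * R.μ))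
      = ∫ x in Set.Ioc (0 : ℝ) 1, c * φ ^ (R.L * R.μ) * (c' * γE ^ (-(E.L * E.μ))) *
        γR ^ (-(R.L * R.μ)) * x ^ (R.L * R.μ + E.L * E.μ - 1) := by
        rw [integral_const_mul, hI]
        ring
    _ ≤ ∫ x in Set.Ioc (0 : ℝ) 1, R.snrCDF p γR (φ * x) * E.snrPDF p γE x := by
        refine setIntegral_mono_on
          (((intervalIntegrable_iff_integrableOn_Ioc_of_le zero_le_one).1 hi).const_mul _)
          (hint.mono_set Set.Ioc_subset_Ioi_self) measurableSet_Ioc fun x hx => ?_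
        have hx0 : 0 < x := hx.1
        have b1 := hR γR h2 (φ * x) (by positivity) (mul_le_of_le_one_right hφ.le hx.2)
        have b2 := hE γE le_rfl x hx0 hx.2
        refine le_trans (le_of_eq ?_) (mul_le_mul b1 b2 (by positivity)
          (R.snrCDF_nonneg hp hγR (by positivity)))
        rw [Real.mul_rpow hφ.le hx0.le, show R.L * R.μ + E.L * E.μ - 1 =
          R.L * R.μ + (E.L * E.μ - 1) by ring, Real.rpow_add hx0]
        ring
    _ ≤ ∫ x in Set.Ioi (0 : ℝ), R.snrCDF p γR (φ * x) * E.snrPDF p γE x := by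
        refine setIntegral_mono_set hint ?_ Set.Ioc_subset_Ioi_self.eventuallyLE
        filter_upwards [ae_restrict_mem measurableSet_Ioi] with x hx
        have hx : 0 < x := hx
        exact mul_nonneg (R.snrCDF_nonneg hp hγR (by positivity)) (E.snrPDF_pos hp hγE hx).le

theorem isBigO_SOP₁_sub (p : ℕ) {φ : ℝ} (hφ : 0 < φ) (R E : RFLink)
    (hres : ∀ (i : Fin 3) (z : ℤ), E.Ψ i - R.L * R.μ ≠ z) {γE : ℝ} (hγE : 0 < γE) :
    (fun γR : ℝ => SOP₁ p φ R E γR γE - SOP₁Inf p φ R E γR γE) =O[atTop]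
      fun γR : ℝ => γR ^ (-(R.L * R.μ + 1)) := by
  obtain ⟨d, hd, hdE⟩ := exists_K₂_ratio_eq_div hφ R E hγE
  have hm := R.L_mul_μ_pos
  have hm' := E.L_mul_μ_pos
  have key : ∀ iR kR iE kE, (fun γR : ℝ => R.K₁ p iR kR * E.K₁ p iE kE *
      (ratioMain (R.Ψ iR) (R.L * R.μ + (kR : ℕ)) (E.Ψ iE) (E.L * E.μ + (kE : ℕ)) (d / γR) -
      ratioIntegral (R.Ψ iR) (R.L * R.μ + kR) (E.Ψ iE) (E.L * E.μ + kE) (d / γR))) =O[atTop]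
      fun γR : ℝ => γR ^ (-(R.L * R.μ + 1)) := by
    intro iR kR iE kE
    refine IsBigO.const_mul_left ?_ _
    obtain ⟨C, hC⟩ := integral_ratioCDF_mul_ratioPDF_expansion (a := R.L * R.μ + kR)
      (a' := E.L * E.μ + kE) (R.Ψ_pos iR) (by positivity)
      (E.Ψ_pos iE) (by positivity) (fun z hz => hres iE (z + kR) (by push_cast; linarith))
    refine IsBigO.of_bound (|C| * d ^ (R.L * R.μ + 1)) ?_
    filter_upwards [eventually_div_le_one d, eventually_gt_atTop 0] with γ h1 h2
    have hδ : 0 < d / γ := by positivity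
    have := hC (d / γ) hδ h1
    rw [Real.norm_eq_abs, abs_sub_comm, Real.norm_of_nonneg (by positivity), ratioIntegral]
    refine this.trans ?_
    have e : d ^ (R.L * R.μ + 1) * γ ^ (-(R.L * R.μ + 1)) = (d / γ) ^ (R.L * R.μ + 1) := by
      rw [Real.div_rpow hd.le h2.le, Real.rpow_neg h2.le, div_eq_mul_inv]
    rw [mul_assoc, e]
    -- The term has error exponent `L_R μ_R + kR + 1`; as `d / γ ≤ 1`, the worst case is `kR = 0`.
    refine mul_le_mul (le_abs_self C) (Real.rpow_le_rpow_of_exponent_ge hδ h1 ?_)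
      (by positivity) (abs_nonneg C)
    have : (0 : ℝ) ≤ kR := Nat.cast_nonneg _
    linarith
  have hsum := IsBigO.sum (s := (Finset.univ : Finset (Fin 3))) fun iR _ =>
    IsBigO.sum (s := Finset.range (p + 1)) fun kR _ =>
      IsBigO.sum (s := (Finset.univ : Finset (Fin 3))) fun iE _ =>
        IsBigO.sum (s := Finset.range (p + 1)) fun kE _ => key iR kR iE kE
  refine hsum.congr' ?_ EventuallyEq.rfl
  filter_upwards [eventually_div_le_one d, eventually_gt_atTop 0] with γ h1 h2
  have e1 := one_sub_SOP₁Inf_eq p hφ R E hres h2 hγE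
  have e2 := (integrableOn_and_integral_rf p hφ R E hres h2 hγE (by rwa [hdE])).2
  rw [show SOP₁ p φ R E γ γE - SOP₁Inf p φ R E γ γE =
    (1 - SOP₁Inf p φ R E γ γE) - (1 - SOP₁ p φ R E γ γE) by ring, e1, SOP₁, sub_sub_cancel, e2,
    hdE]
  simp only [← Finset.sum_sub_distrib, mul_sub, Finset.sum_apply]

theorem tendsto_ratioMain {Ψ a Ψ' a' : ℝ} (ha : 0 < a) (hΨ' : 0 < Ψ') (d : ℝ) :
    Tendsto (fun γ : ℝ => ratioMain Ψ a Ψ' a' (d / γ)) atTop (nhds 0) := by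
  have h : Continuous (ratioMain Ψ a Ψ' a') := by
    have h1 : Continuous fun x : ℝ => x ^ Ψ' := Real.continuous_rpow_const hΨ'.le
    have h2 : Continuous fun x : ℝ => x ^ a := Real.continuous_rpow_const ha.le
    unfold ratioMain
    fun_prop
  have h0 : ratioMain Ψ a Ψ' a' 0 = 0 := by
    simp [ratioMain, Real.zero_rpow ha.ne', Real.zero_rpow hΨ'.ne']
  have := (h.tendsto 0).comp (tendsto_const_nhds.div_atTop tendsto_id (a := d) (l := atTop))
  rwa [h0] at this

theorem tendsto_one_sub_SOP₁Inf (p : ℕ) {φ : ℝ} (hφ : 0 < φ) (R E : RFLink)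
    (hres : ∀ (i : Fin 3) (z : ℤ), E.Ψ i - R.L * R.μ ≠ z) {γE : ℝ} (hγE : 0 < γE) :
    Tendsto (fun γR : ℝ => 1 - SOP₁Inf p φ R E γR γE) atTop (nhds 0) := by
  obtain ⟨d, hd, hdE⟩ := exists_K₂_ratio_eq_div hφ R E hγE
  have hm := R.L_mul_μ_pos
  have : Tendsto (fun γR : ℝ => ∑ iR : Fin 3, ∑ kR ∈ Finset.range (p + 1), ∑ iE : Fin 3,
      ∑ kE ∈ Finset.range (p + 1), R.K₁ p iR kR * E.K₁ p iE kE *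
        ratioMain (R.Ψ iR) (R.L * R.μ + kR) (E.Ψ iE) (E.L * E.μ + kE) (d / γR)) atTop
      (nhds (∑ iR : Fin 3, ∑ kR ∈ Finset.range (p + 1), ∑ iE : Fin 3,
        ∑ kE ∈ Finset.range (p + 1), R.K₁ p iR kR * E.K₁ p iE kE * 0)) :=
    tendsto_finsetSum _ fun iR _ => tendsto_finsetSum _ fun kR _ =>
      tendsto_finsetSum _ fun iE _ => tendsto_finsetSum _ fun kE _ =>
        (tendsto_ratioMain (by positivity) (E.Ψ_pos iE) d).const_mul _
  simp only [mul_zero, Finset.sum_const_zero] at this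
  refine this.congr' ?_
  filter_upwards [eventually_gt_atTop 0] with γ hγ
  rw [one_sub_SOP₁Inf_eq p hφ R E hres hγ hγE, hdE]

/-- The error is one power smaller than the lower bound for `u`, hence negligible against `u` even
if `u` decays more slowly than `t ^ (-a)`. -/
theorem isEquivalent_of_isBigO_sub_of_le {u u' : ℝ → ℝ} {a c : ℝ} (hc : 0 < c)
    (h : (fun t => u t - u' t) =O[atTop] fun t : ℝ => t ^ (-(a + 1)))
    (hu : ∀ᶠ t in atTop, c * t ^ (-a) ≤ u t) : u ~[atTop] u' := by
  refine IsEquivalent.symm ?_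
  have h1 : (fun t : ℝ => t ^ (-(a + 1))) =o[atTop] fun t : ℝ => t ^ (-a) := by
    have h0 : (fun t : ℝ => t⁻¹) =o[atTop] fun _ : ℝ => (1 : ℝ) :=
      (isLittleO_one_iff ℝ).2 tendsto_inv_atTop_zero
    refine ((isBigO_refl (fun t : ℝ => t ^ (-a)) atTop).mul_isLittleO h0).congr' ?_ ?_
    · filter_upwards [eventually_gt_atTop 0] with t ht
      rw [← Real.rpow_neg_one, ← Real.rpow_add ht]
      ring_nf
    · exact Eventually.of_forall fun t => mul_one _
  have h2 : (fun t : ℝ => t ^ (-a)) =O[atTop] u := by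
    refine IsBigO.of_bound c⁻¹ ?_
    filter_upwards [hu, eventually_gt_atTop 0] with t ht ht0
    have hp : 0 < t ^ (-a) := Real.rpow_pos_of_pos ht0 _
    rw [Real.norm_of_nonneg hp.le, Real.norm_of_nonneg (le_trans (by positivity) ht),
      ← div_eq_inv_mul, le_div_iff₀ hc, mul_comm]
    exact ht
  refine IsLittleO.trans_isBigO (IsBigO.trans_isLittleO ?_ h1) h2
  refine h.neg_left.congr_left fun t => ?_
  simp

/-! ### Moments of the optical gains and positivity of the Gamma parameters. -/

namespace OpticalHop

variable (h : OpticalHop)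

/-- Moments of the turbulence gain. -/
noncomputable def turbulenceMoment (s : ℕ) : ℝ :=
  ∫ x in Set.Ioi (0 : ℝ), h.turbulencePDF x * x ^ s

/-- Moments of the pointing gain. -/
noncomputable def pointingMoment (s : ℕ) : ℝ :=
  ∫ x in Set.Ioc (0 : ℝ) h.J, h.pointingPDF x * x ^ s

theorem measurable_turbulencePDF : Measurable h.turbulencePDF := by
  unfold turbulencePDF
  fun_prop

theorem measurable_pointingPDF : Measurable h.pointingPDF := by
  unfold pointingPDF
  fun_prop

theorem turbulencePDF_nonneg {x : ℝ} (hx : 0 < x) : 0 ≤ h.turbulencePDF x := by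
  have h1 := h.w_pos
  have h2 := sub_pos.2 h.w_lt_one
  have h3 := h.ν_pos
  have h4 := h.b_pos
  have h5 := h.c_pos
  have h6 := Real.Gamma_pos_of_pos h.a_pos
  unfold turbulencePDF
  positivity

theorem pointingPDF_nonneg {x : ℝ} (hx : 0 < x) : 0 ≤ h.pointingPDF x := by
  have h1 := h.J_pos
  unfold pointingPDF
  positivity

instance : SFinite h.gainLaw := by
  unfold gainLaw
  infer_instance

theorem integral_pow_gainLaw (s : ℕ) :
    ∫ x, x ^ s ∂h.gainLaw = h.turbulenceMoment s * h.pointingMoment s := by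
  rw [gainLaw, integral_map (by fun_prop) (by fun_prop)]
  simp_rw [mul_pow]
  rw [integral_prod_mul (fun x : ℝ => x ^ s) (fun x : ℝ => x ^ s),
    integral_withDensity_eq_integral_toReal_smul h.measurable_turbulencePDF.ennreal_ofReal
      (ae_of_all _ fun _ => ENNReal.ofReal_lt_top),
    integral_withDensity_eq_integral_toReal_smul h.measurable_pointingPDF.ennreal_ofReal
      (ae_of_all _ fun _ => ENNReal.ofReal_lt_top), turbulenceMoment, pointingMoment]
  congr 1
  · refine setIntegral_congr_fun measurableSet_Ioi fun x hx => ?_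
    simp only [smul_eq_mul]
    rw [ENNReal.toReal_ofReal (h.turbulencePDF_nonneg hx)]
  · refine setIntegral_congr_fun measurableSet_Ioc fun x hx => ?_
    simp only [smul_eq_mul]
    rw [ENNReal.toReal_ofReal (h.pointingPDF_nonneg hx.1)]

theorem pointingMoment_eq (s : ℕ) :
    h.pointingMoment s = h.ξ ^ 2 * h.J ^ s / (h.ξ ^ 2 + s) := by
  have h1 := h.J_pos
  have h2 : 0 < h.ξ ^ 2 := pow_pos h.ξ_pos 2
  have hs : 0 < h.ξ ^ 2 + s := by positivity
  have hc : Set.EqOn (fun x => h.pointingPDF x * x ^ s)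
      (fun x => h.ξ ^ 2 / h.J ^ (h.ξ ^ 2) * x ^ (h.ξ ^ 2 + s - 1)) (Set.Ioc 0 h.J) := by
    intro x hx
    simp only [pointingPDF]
    rw [show h.ξ ^ 2 + (s : ℝ) - 1 = h.ξ ^ 2 - 1 + s by ring, Real.rpow_add hx.1,
      Real.rpow_natCast]
    ring
  rw [pointingMoment, setIntegral_congr_fun measurableSet_Ioc hc,
    ← intervalIntegral.integral_of_le h1.le, intervalIntegral.integral_const_mul,
    integral_rpow (Or.inl (by linarith)), sub_add_cancel, Real.zero_rpow hs.ne', sub_zero,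
    Real.rpow_add h1, Real.rpow_natCast]
  have := (Real.rpow_pos_of_pos h1 (h.ξ ^ 2)).ne'
  field_simp

theorem integrableOn_and_turbulenceMoment_eq (s : ℕ) :
    IntegrableOn (fun x => h.turbulencePDF x * x ^ s) (Set.Ioi 0) ∧
      h.turbulenceMoment s = h.w * (h.ν ^ s * Real.Gamma (s + 1)) +
        (1 - h.w) * (h.b ^ s * Real.Gamma (h.a + s / h.c) / Real.Gamma h.a) := by
  have hν := h.ν_pos
  have ha := h.a_pos
  have hb := h.b_pos
  have hc := h.c_pos
  have hΓ := Real.Gamma_pos_of_pos ha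
  have hs : (0 : ℝ) ≤ s := Nat.cast_nonneg s
  have hac : 0 < h.a * h.c := by positivity
  have hbc : 0 < h.b ^ (-h.c) := by positivity
  have hq : -1 < h.a * h.c + s - 1 := by linarith
  have i1 := (integrableOn_rpow_mul_exp_neg_mul (a := s + 1) (by linarith)
    (one_div_pos.2 hν)).const_mul (h.w * (1 / h.ν))
  have i2 := (integrableOn_rpow_mul_exp_neg_mul_rpow hq hc hbc).const_mul
    ((1 - h.w) * (h.c / (h.b ^ (h.a * h.c) * Real.Gamma h.a)))
  have hcongr : Set.EqOn (fun x => h.turbulencePDF x * x ^ s)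
      (fun x => h.w * (1 / h.ν) * (x ^ ((s : ℝ) + 1 - 1) * Real.exp (-(1 / h.ν * x))) +
        (1 - h.w) * (h.c / (h.b ^ (h.a * h.c) * Real.Gamma h.a)) *
          (x ^ (h.a * h.c + s - 1) * Real.exp (-h.b ^ (-h.c) * x ^ h.c))) (Set.Ioi 0) := by
    intro x hx
    have hx : 0 < x := hx
    simp only [turbulencePDF]
    rw [add_sub_cancel_right, Real.rpow_natCast, show h.a * h.c + (s : ℝ) - 1 =
      h.a * h.c - 1 + s by ring, Real.rpow_add hx, Real.rpow_natCast, Real.div_rpow hx.le hb.le,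
      Real.rpow_neg hb.le]
    ring_nf
  refine ⟨(integrableOn_congr_fun hcongr measurableSet_Ioi).2 (i1.add i2), ?_⟩
  rw [turbulenceMoment, setIntegral_congr_fun measurableSet_Ioi hcongr, integral_add i1 i2,
    integral_const_mul, integral_const_mul,
    Real.integral_rpow_mul_exp_neg_mul_Ioi (by linarith) (one_div_pos.2 hν),
    integral_rpow_mul_exp_neg_mul_rpow hc hq hbc, one_div_one_div, Real.rpow_add_one hν.ne',
    Real.rpow_natCast, ← Real.rpow_mul hb.le,
    show -h.c * (-(h.a * h.c + s - 1 + 1) / h.c) = h.a * h.c + s by field_simp; ring,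
    show (h.a * h.c + s - 1 + 1) / h.c = h.a + s / h.c by field_simp; ring,
    Real.rpow_add hb, Real.rpow_natCast]
  have := (Real.rpow_pos_of_pos hb (h.a * h.c)).ne'
  field_simp

theorem turbulenceMoment_pos (s : ℕ) : 0 < h.turbulenceMoment s := by
  have h1 := h.w_pos
  have h2 := sub_pos.2 h.w_lt_one
  have h3 := h.ν_pos
  have h4 := h.b_pos
  have h5 := h.c_pos
  have h6 := h.a_pos
  have h7 := Real.Gamma_pos_of_pos h.a_pos
  have hs : (0 : ℝ) ≤ s := Nat.cast_nonneg s
  have h8 : 0 < Real.Gamma (s + 1) := Real.Gamma_pos_of_pos (by linarith)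
  have h9 : 0 < Real.Gamma (h.a + s / h.c) := Real.Gamma_pos_of_pos (by positivity)
  rw [(h.integrableOn_and_turbulenceMoment_eq s).2]
  positivity

theorem turbulenceMoment_zero : h.turbulenceMoment 0 = 1 := by
  have := (Real.Gamma_pos_of_pos h.a_pos).ne'
  rw [(h.integrableOn_and_turbulenceMoment_eq 0).2]
  simp [this]

theorem sq_turbulenceMoment_one_le : h.turbulenceMoment 1 ^ 2 ≤ h.turbulenceMoment 2 := by
  have i0 := (h.integrableOn_and_turbulenceMoment_eq 0).1
  have i1 := (h.integrableOn_and_turbulenceMoment_eq 1).1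
  have i2 := (h.integrableOn_and_turbulenceMoment_eq 2).1
  set M := h.turbulenceMoment 1 with hM
  have h0 : 0 ≤ ∫ x in Set.Ioi (0 : ℝ), h.turbulencePDF x * (x - M) ^ 2 :=
    setIntegral_nonneg measurableSet_Ioi fun x hx =>
      mul_nonneg (h.turbulencePDF_nonneg hx) (sq_nonneg _)
  have e : ∀ x, h.turbulencePDF x * (x - M) ^ 2 = h.turbulencePDF x * x ^ 2 -
      2 * M * (h.turbulencePDF x * x ^ 1) + M ^ 2 * (h.turbulencePDF x * x ^ 0) := fun x => by ring
  simp_rw [e] at h0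
  have i3 : IntegrableOn (fun x => h.turbulencePDF x * x ^ 2 -
      2 * M * (h.turbulencePDF x * x ^ 1)) (Set.Ioi 0) := i2.sub (i1.const_mul _)
  rw [integral_add i3 (i0.const_mul _), integral_sub i2 (i1.const_mul _),
    integral_const_mul, integral_const_mul] at h0
  change 0 ≤ h.turbulenceMoment 2 - 2 * M * h.turbulenceMoment 1 +
    M ^ 2 * h.turbulenceMoment 0 at h0
  rw [turbulenceMoment_zero, ← hM] at h0
  linarith

theorem pointingMoment_pos (s : ℕ) : 0 < h.pointingMoment s := by
  have h1 := h.J_pos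
  have h2 : 0 < h.ξ ^ 2 := pow_pos h.ξ_pos 2
  rw [pointingMoment_eq]
  positivity

/-- With `e = ξ²` this is `e (e + 2) < (e + 1)²`. The strictness here suffices for `Var Y > 0`; the
turbulence factors need only the weak inequality. -/
theorem sq_pointingMoment_one_lt : h.pointingMoment 1 ^ 2 < h.pointingMoment 2 := by
  have h1 := h.J_pos
  have h2 : 0 < h.ξ ^ 2 := pow_pos h.ξ_pos 2
  rw [pointingMoment_eq, pointingMoment_eq]
  push_cast
  generalize h.ξ ^ 2 = e at *
  rw [div_pow, div_lt_div_iff₀ (by positivity) (by positivity)]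
  have : 0 < e * h.J ^ 2 := by positivity
  nlinarith

end OpticalHop

namespace RISLink

variable (n : RISLink)

theorem moment_eq (s : ℕ) : n.moment s =
    n.hopIn.turbulenceMoment s * n.hopIn.pointingMoment s *
      (n.hopOut.turbulenceMoment s * n.hopOut.pointingMoment s) := by
  rw [moment]
  simp_rw [mul_pow]
  rw [integral_prod_mul (fun x : ℝ => x ^ s) (fun x : ℝ => x ^ s),
    OpticalHop.integral_pow_gainLaw, OpticalHop.integral_pow_gainLaw]

theorem moment_pos (s : ℕ) : 0 < n.moment s := by
  rw [moment_eq]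
  exact mul_pos (mul_pos (OpticalHop.turbulenceMoment_pos _ s) (OpticalHop.pointingMoment_pos _ s))
    (mul_pos (OpticalHop.turbulenceMoment_pos _ s) (OpticalHop.pointingMoment_pos _ s))

theorem sq_moment_one_lt : n.moment 1 ^ 2 < n.moment 2 := by
  rw [moment_eq, moment_eq, mul_pow, mul_pow, mul_pow]
  have t1 := n.hopIn.turbulenceMoment_pos 2
  have t2 := n.hopOut.turbulenceMoment_pos 2
  have p1 := n.hopIn.pointingMoment_pos 2
  have p2 := n.hopOut.pointingMoment_pos 2
  have a1 := n.hopIn.sq_turbulenceMoment_one_le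
  have a2 := n.hopOut.sq_turbulenceMoment_one_le
  have b1 := n.hopIn.sq_pointingMoment_one_lt
  have b2 := n.hopOut.sq_pointingMoment_one_lt
  have aux : ∀ {x y x' y' : ℝ}, 0 < x' → 0 ≤ y → x ≤ x' → y < y' → x * y < x' * y' :=
    fun h1 h2 h3 h4 => mul_lt_mul' h3 h4 h2 h1
  exact mul_lt_mul'' (aux t1 (sq_nonneg _) a1 b1) (aux t2 (sq_nonneg _) a2 b2)
    (by positivity) (by positivity)

theorem meanχ_pos : 0 < n.meanχ :=
  mul_pos (Nat.cast_pos.2 n.N_pos) (n.moment_pos 1)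

theorem varχ_pos : 0 < n.varχ :=
  mul_pos (Nat.cast_pos.2 n.N_pos) (sub_pos.2 n.sq_moment_one_lt)

theorem ρ_pos : 0 < n.ρ := div_pos (pow_pos n.meanχ_pos 2) n.varχ_pos

theorem ω_pos : 0 < n.ω := div_pos n.varχ_pos n.meanχ_pos

theorem r_pos : (0 : ℝ) < n.r := by
  rcases n.r_eq with h | h <;> rw [h] <;> norm_num

theorem shape_pos : 0 < n.ρ / n.r := div_pos n.ρ_pos n.r_pos

theorem Υ₁_pos {τ : ℝ} (hτ : 0 < τ) : 0 < n.Υ₁ τ := by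
  have h1 := n.moment_pos 1
  have h2 := n.r_pos
  have h3 := n.ω_pos
  have h4 := Real.Gamma_pos_of_pos n.ρ_pos
  unfold Υ₁
  positivity

theorem Υ₂_pos {τ : ℝ} (hτ : 0 < τ) : 0 < n.Υ₂ τ := by
  have h1 := n.moment_pos 1
  have h3 := n.ω_pos
  unfold Υ₂
  positivity

theorem Υ₁_eq {τ : ℝ} (hτ : 0 < τ) : n.Υ₁ τ = n.Υ₁ 1 * τ ^ (-(n.ρ / n.r)) := by
  rw [Υ₁, Υ₁, Real.one_rpow, Real.rpow_neg hτ.le]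
  ring

theorem Υ₂_eq {τ : ℝ} (hτ : 0 < τ) : n.Υ₂ τ = n.Υ₂ 1 * τ ^ (-(1 / (n.r : ℝ))) := by
  rw [Υ₂, Υ₂, Real.one_rpow, Real.rpow_neg hτ.le]
  ring

theorem Υ₃_eq (τ : ℝ) :
    n.Υ₃ τ = n.Υ₁ τ * (√n.r / (2 * Real.pi) ^ (((n.r : ℝ) - 1) / 2)) := by
  have h2 := n.r_pos
  have h3 := Real.mul_self_sqrt h2.le
  have h4 := (Real.sqrt_pos.2 h2).ne'
  rw [Υ₃, Υ₁]
  generalize (2 * Real.pi) ^ (((n.r : ℝ) - 1) / 2) = P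
  generalize τ ^ (n.ρ / n.r) = t
  field_simp
  rw [sq, h3]

theorem Υ₄_eq {τ : ℝ} (hτ : 0 < τ) : n.Υ₄ τ = n.Υ₂ τ ^ n.r / (n.r : ℝ) ^ n.r := by
  have h2 := n.r_pos
  have e : (τ ^ (1 / (n.r : ℝ))) ^ n.r = τ := by
    rw [← Real.rpow_natCast, ← Real.rpow_mul hτ.le, one_div_mul_cancel h2.ne', Real.rpow_one]
  rw [Υ₄, Υ₂, div_pow, mul_pow, e]
  field_simp

end RISLink

/-! ### Expansion of the optical outage integral with remainder. -/

theorem abs_exp_neg_sub_sum_le {m : ℕ} (hm : m ≤ 2) {z : ℝ} (hz : 0 ≤ z) :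
    |Real.exp (-z) - ∑ k ∈ Finset.range m, (-z) ^ k / (k.factorial : ℝ)| ≤ z ^ m := by
  have h1 := Real.add_one_le_exp (-z)
  have h2 : Real.exp (-z) ≤ 1 := Real.exp_le_one_iff.2 (by linarith)
  interval_cases m
  · simpa using h2
  · simp only [Finset.sum_range_one, pow_zero, Nat.factorial_zero, Nat.cast_one, div_one, pow_one]
    rw [abs_le]
    constructor <;> linarith
  · simp only [Finset.sum_range_succ, Finset.sum_range_zero, pow_zero, Nat.factorial_zero,
      Nat.cast_one, div_one, pow_one, Nat.factorial_one, zero_add]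
    have h3 := Real.add_one_le_exp z
    have h4 : Real.exp (-z) * Real.exp z = 1 := by rw [← Real.exp_add]; simp
    have h5 := Real.exp_pos (-z)
    -- The second-order upper bound comes from `e ^ (-z) ≤ 1 / (1 + z) ≤ 1 - z + z ^ 2`.
    have h6 : Real.exp (-z) * (1 + z) ≤ 1 := by nlinarith
    have h7 : Real.exp (-z) ≤ 1 - z + z ^ 2 := by
      have : 0 < 1 + z := by linarith
      have h8 : (1 - z + z ^ 2) * (1 + z) = 1 + z ^ 3 := by ring
      have h9 : 0 ≤ z ^ 3 := by positivity
      nlinarith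
    rw [abs_le]
    constructor <;> nlinarith [sq_nonneg z]

namespace RISLink

variable (n : RISLink)

theorem measurable_snrPDF (τ : ℝ) : Measurable (n.snrPDF τ) := by
  unfold snrPDF
  fun_prop

theorem intervalIntegrable_snrPDF (τ x y : ℝ) : IntervalIntegrable (n.snrPDF τ) volume x y := by
  have h0 := n.shape_pos
  have h1 : Continuous fun t : ℝ => t ^ (1 / (n.r : ℝ)) :=
    Real.continuous_rpow_const (by have := n.r_pos; positivity)
  exact ((intervalIntegral.intervalIntegrable_rpow' (by linarith)).const_mul _).mul_continuousOn
    (by fun_prop)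

theorem continuous_snrCDF (τ : ℝ) : Continuous (n.snrCDF τ) :=
  intervalIntegral.continuous_primitive (n.intervalIntegrable_snrPDF τ) 0

theorem snrPDF_nonneg {τ x : ℝ} (hτ : 0 < τ) (hx : 0 < x) : 0 ≤ n.snrPDF τ x := by
  have := n.Υ₁_pos hτ
  unfold snrPDF
  positivity

/-- The Taylor bound for `e ^ (-z)` at `z = Υ₂ t ^ (1 / r)` is integrated term by term; each further
order contributes a factor `Υ₂` and raises the exponent by `1 / r`. -/
theorem abs_snrCDF_sub_sum_le {m : ℕ} (hm : m ≤ 2) {τ y : ℝ} (hτ : 0 < τ) (hy : 0 < y) :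
    |n.snrCDF τ y - ∑ k ∈ Finset.range m, n.Υ₁ τ * ((-n.Υ₂ τ) ^ k / (k.factorial : ℝ)) *
      (y ^ (n.ρ / n.r + k / n.r) / (n.ρ / n.r + k / n.r))| ≤
      n.Υ₁ τ * n.Υ₂ τ ^ m * (y ^ (n.ρ / n.r + m / n.r) / (n.ρ / n.r + m / n.r)) := by
  have hr := n.r_pos
  have ha := n.shape_pos
  have h1 := n.Υ₁_pos hτ
  have h2 := n.Υ₂_pos hτ
  have hk : ∀ k : ℕ, 0 < n.ρ / n.r + k / n.r := fun k => by positivity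
  have hI : ∀ k : ℕ, IntervalIntegrable (fun t : ℝ => t ^ (n.ρ / n.r + k / n.r - 1))
      volume 0 y := fun k => intervalIntegral.intervalIntegrable_rpow' (by linarith [hk k])
  have hv : ∀ k : ℕ, ∫ t in (0 : ℝ)..y, t ^ (n.ρ / n.r + k / n.r - 1) =
      y ^ (n.ρ / n.r + k / n.r) / (n.ρ / n.r + k / n.r) := fun k => by
    rw [integral_rpow (Or.inl (by linarith [hk k])), sub_add_cancel, Real.zero_rpow (hk k).ne',
      sub_zero]
  have hpow : ∀ (k : ℕ) {t : ℝ}, 0 < t → t ^ (n.ρ / n.r + k / n.r - 1) =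
      t ^ (n.ρ / n.r - 1) * (t ^ (1 / (n.r : ℝ))) ^ k := fun k t ht => by
    rw [← Real.rpow_natCast, ← Real.rpow_mul ht.le, ← Real.rpow_add ht]
    congr 1
    ring
  have hS : IntervalIntegrable (fun t => ∑ k ∈ Finset.range m,
      n.Υ₁ τ * ((-n.Υ₂ τ) ^ k / (k.factorial : ℝ)) * t ^ (n.ρ / n.r + k / n.r - 1))
      volume 0 y := by
    have := IntervalIntegrable.sum (Finset.range m) fun k _ =>
      (hI k).const_mul (n.Υ₁ τ * ((-n.Υ₂ τ) ^ k / (k.factorial : ℝ)))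
    rwa [Finset.sum_fn] at this
  have hf := n.intervalIntegrable_snrPDF τ 0 y
  simp_rw [← hv, ← intervalIntegral.integral_const_mul]
  rw [snrCDF, ← intervalIntegral.integral_finsetSum fun k _ => (hI k).const_mul _,
    ← intervalIntegral.integral_sub hf hS]
  refine (intervalIntegral.abs_integral_le_integral_abs hy.le).trans ?_
  refine intervalIntegral.integral_mono_on_of_le_Ioo hy.le (hf.sub hS).abs
    ((hI m).const_mul _) fun t ht => ?_
  have ht0 : 0 < t := ht.1
  have e : n.snrPDF τ t - ∑ k ∈ Finset.range m,
      n.Υ₁ τ * ((-n.Υ₂ τ) ^ k / (k.factorial : ℝ)) * t ^ (n.ρ / n.r + k / n.r - 1) =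
      n.Υ₁ τ * t ^ (n.ρ / n.r - 1) * (Real.exp (-(n.Υ₂ τ * t ^ (1 / (n.r : ℝ)))) -
        ∑ k ∈ Finset.range m, (-(n.Υ₂ τ * t ^ (1 / (n.r : ℝ)))) ^ k / (k.factorial : ℝ)) := by
    rw [snrPDF, mul_sub, Finset.mul_sum]
    congr 1
    refine Finset.sum_congr rfl fun k _ => ?_
    rw [hpow k ht0, ← neg_mul, mul_pow]
    ring
  rw [e, abs_mul, abs_of_pos (by positivity)]
  refine (mul_le_mul_of_nonneg_left (abs_exp_neg_sub_sum_le hm (by positivity))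
    (by positivity)).trans (le_of_eq ?_)
  rw [hpow m ht0, mul_pow]
  ring

/-- Moments of the SNR. -/
noncomputable def snrMoment (τ s : ℝ) : ℝ := ∫ x in Set.Ioi (0 : ℝ), x ^ s * n.snrPDF τ x

theorem integrableOn_and_snrMoment_eq {τ s : ℝ} (hτ : 0 < τ) (hs : 0 ≤ s) :
    IntegrableOn (fun x => x ^ s * n.snrPDF τ x) (Set.Ioi 0) ∧
      n.snrMoment τ s = n.Υ₁ τ * (n.r * n.Υ₂ τ ^ (-(n.r * (s + n.ρ / n.r))) *
        Real.Gamma (n.r * (s + n.ρ / n.r))) := by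
  have hr := n.r_pos
  have ha := n.shape_pos
  have h2 := n.Υ₂_pos hτ
  have hq : -1 < s + n.ρ / n.r - 1 := by linarith
  have hr' : 0 < 1 / (n.r : ℝ) := by positivity
  have hc : Set.EqOn (fun x => x ^ s * n.snrPDF τ x) (fun x => n.Υ₁ τ *
      (x ^ (s + n.ρ / n.r - 1) * Real.exp (-n.Υ₂ τ * x ^ (1 / (n.r : ℝ))))) (Set.Ioi 0) := by
    intro x hx
    simp only [snrPDF]
    rw [add_sub_assoc, Real.rpow_add hx, neg_mul]
    ring
  refine ⟨(integrableOn_congr_fun hc measurableSet_Ioi).2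
    ((integrableOn_rpow_mul_exp_neg_mul_rpow hq hr' h2).const_mul _), ?_⟩
  rw [snrMoment, setIntegral_congr_fun measurableSet_Ioi hc, integral_const_mul,
    integral_rpow_mul_exp_neg_mul_rpow hr' hq h2, sub_add_cancel, one_div_one_div,
    show -(s + n.ρ / n.r) / (1 / (n.r : ℝ)) = -(n.r * (s + n.ρ / n.r)) by field_simp,
    show (s + n.ρ / n.r) / (1 / (n.r : ℝ)) = n.r * (s + n.ρ / n.r) by field_simp]
  ring

theorem snrMoment_pos {τ s : ℝ} (hτ : 0 < τ) (hs : 0 ≤ s) : 0 < n.snrMoment τ s := by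
  have hr := n.r_pos
  have ha := n.shape_pos
  have h1 := n.Υ₁_pos hτ
  have h2 := n.Υ₂_pos hτ
  have h3 : 0 < Real.Gamma (n.r * (s + n.ρ / n.r)) := Real.Gamma_pos_of_pos (by positivity)
  rw [(n.integrableOn_and_snrMoment_eq hτ hs).2]
  positivity

end RISLink

/-- The first `m` terms of the expansion of `1 - SOP₂` at large `τD`. -/
noncomputable def opticalMain (m : ℕ) (φ : ℝ) (D E' : RISLink) (τD τE : ℝ) : ℝ :=
  ∑ k ∈ Finset.range m, D.Υ₁ τD * ((-D.Υ₂ τD) ^ k / (k.factorial : ℝ)) *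
    (φ ^ (D.ρ / D.r + k / D.r) / (D.ρ / D.r + k / D.r)) *
    E'.snrMoment τE (D.ρ / D.r + k / D.r)

theorem abs_one_sub_SOP₂_sub_opticalMain_le {m : ℕ} (hm : m ≤ 2) {φ : ℝ} (hφ : 0 < φ)
    (D E' : RISLink) {τD τE : ℝ} (hτD : 0 < τD) (hτE : 0 < τE) :
    |1 - SOP₂ φ D E' τD τE - opticalMain m φ D E' τD τE| ≤
      D.Υ₁ τD * D.Υ₂ τD ^ m * (φ ^ (D.ρ / D.r + m / D.r) / (D.ρ / D.r + m / D.r) *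
        E'.snrMoment τE (D.ρ / D.r + m / D.r)) := by
  have hr := D.r_pos
  have ha := D.shape_pos
  have h1 := D.Υ₁_pos hτD
  have h2 := D.Υ₂_pos hτD
  have hk : ∀ k : ℕ, 0 ≤ D.ρ / D.r + k / D.r := fun k => by positivity
  have hM := fun k => (E'.integrableOn_and_snrMoment_eq hτE (hk k)).1
  have hF : IntegrableOn (fun x => D.snrCDF τD (φ * x) * E'.snrPDF τE x) (Set.Ioi 0) := by
    -- The case `m = 0` of the remainder bound is `F(y) ≤ const * y ^ (ρ / r)`, a majorant with
    -- finite moment.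
    refine ((hM 0).const_mul (D.Υ₁ τD * (φ ^ (D.ρ / D.r + (0 : ℕ) / D.r) /
      (D.ρ / D.r + (0 : ℕ) / D.r)))).mono' ?_ ?_
    · exact (((D.continuous_snrCDF τD).measurable.comp (measurable_const_mul φ)).mul
        (E'.measurable_snrPDF τE)).aestronglyMeasurable
    · filter_upwards [ae_restrict_mem measurableSet_Ioi] with x hx
      have hx : 0 < x := hx
      have := D.abs_snrCDF_sub_sum_le (m := 0) (by norm_num) hτD (mul_pos hφ hx)
      rw [Finset.sum_range_zero, sub_zero, pow_zero, mul_one, Real.mul_rpow hφ.le hx.le] at this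
      have hp := E'.snrPDF_nonneg hτE hx
      rw [norm_mul, Real.norm_eq_abs, Real.norm_of_nonneg hp]
      refine (mul_le_mul_of_nonneg_right this hp).trans (le_of_eq ?_)
      ring
  have hS : IntegrableOn (fun x => ∑ k ∈ Finset.range m, D.Υ₁ τD *
      ((-D.Υ₂ τD) ^ k / (k.factorial : ℝ)) *
      (φ ^ (D.ρ / D.r + k / D.r) / (D.ρ / D.r + k / D.r)) *
      (x ^ (D.ρ / D.r + k / D.r) * E'.snrPDF τE x)) (Set.Ioi 0) :=
    integrable_finsetSum _ fun k _ => (hM k).const_mul _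
  have hmain : opticalMain m φ D E' τD τE = ∫ x in Set.Ioi (0 : ℝ), ∑ k ∈ Finset.range m,
      D.Υ₁ τD * ((-D.Υ₂ τD) ^ k / (k.factorial : ℝ)) *
      (φ ^ (D.ρ / D.r + k / D.r) / (D.ρ / D.r + k / D.r)) *
      (x ^ (D.ρ / D.r + k / D.r) * E'.snrPDF τE x) := by
    rw [integral_finsetSum _ fun k _ => (hM k).const_mul _, opticalMain]
    refine Finset.sum_congr rfl fun k _ => ?_
    rw [integral_const_mul, RISLink.snrMoment]
  rw [SOP₂, sub_sub_cancel, hmain, ← integral_sub hF hS, RISLink.snrMoment, ← mul_assoc,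
    ← integral_const_mul]
  refine abs_integral_le_integral_abs.trans ?_
  refine setIntegral_mono_on (hF.sub hS).abs ((hM m).const_mul _) measurableSet_Ioi fun x hx => ?_
  have hx : 0 < x := hx
  have hp := E'.snrPDF_nonneg hτE hx
  have := D.abs_snrCDF_sub_sum_le hm hτD (mul_pos hφ hx)
  have e : D.snrCDF τD (φ * x) * E'.snrPDF τE x - ∑ k ∈ Finset.range m, D.Υ₁ τD *
      ((-D.Υ₂ τD) ^ k / (k.factorial : ℝ)) *
      (φ ^ (D.ρ / D.r + k / D.r) / (D.ρ / D.r + k / D.r)) *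
      (x ^ (D.ρ / D.r + k / D.r) * E'.snrPDF τE x) =
      (D.snrCDF τD (φ * x) - ∑ k ∈ Finset.range m, D.Υ₁ τD *
        ((-D.Υ₂ τD) ^ k / (k.factorial : ℝ)) *
        ((φ * x) ^ (D.ρ / D.r + k / D.r) / (D.ρ / D.r + k / D.r))) * E'.snrPDF τE x := by
    rw [sub_mul, Finset.sum_mul]
    congr 1
    refine Finset.sum_congr rfl fun k _ => ?_
    rw [Real.mul_rpow hφ.le hx.le]
    ring
  rw [e, abs_mul, abs_of_nonneg hp]
  refine (mul_le_mul_of_nonneg_right this hp).trans (le_of_eq ?_)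
  rw [Real.mul_rpow hφ.le hx.le]
  ring

/-! ### Identification of `SOP₂Inf` with the truncated expansion. -/

/-- For `r = 2` this is Legendre duplication, `Γ(s) Γ(s + 1/2) = 2 ^ (1 - 2 s) √π Γ(2 s)`, whose
constants absorb the powers of `r` and `2 π`. The right side contains the Gamma value of a moment of
`γ_Ẽ`. -/
theorem RISLink.prod_Gamma_T₅ (E' : RISLink) {U s : ℝ} (hU : 0 < U) :
    √E'.r / (2 * Real.pi) ^ (((E'.r : ℝ) - 1) / 2) * (U ^ E'.r / (E'.r : ℝ) ^ E'.r) ^ (-s) *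
      ∏ l ∈ Finset.Icc 1 (E'.r + 1), Real.Gamma (1 + T₅ E' l - (1 - s)) =
    E'.r * U ^ (-(E'.r * s)) * Real.Gamma (E'.r * s) * Real.Gamma (s - E'.ρ / E'.r) := by
  rcases E'.r_eq with h | h
  · have h12 : Finset.Icc 1 (1 + 1) = {1, 2} := rfl
    simp only [h, h12, T₅, Υ₅]
    rw [Finset.prod_pair (by norm_num)]
    norm_num
    ring_nf
  · have h13 : Finset.Icc 1 (2 + 1) = {1, 2, 3} := rfl
    simp only [h, h13, T₅, Υ₅]
    rw [Finset.prod_insert (by simp), Finset.prod_pair (by norm_num)]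
    have hg := Real.Gamma_mul_Gamma_add_half s
    have e1 : (U ^ 2 / ((2 : ℕ) : ℝ) ^ 2) ^ (-s) = U ^ (-(2 * s)) * 2 ^ (2 * s) := by
      rw [Nat.cast_ofNat, ← div_pow, ← Real.rpow_natCast, ← Real.rpow_mul (by positivity),
        Real.div_rpow hU.le zero_le_two, Nat.cast_ofNat, mul_neg, Real.rpow_neg zero_le_two,
        div_inv_eq_mul]
    have e2 : (2 : ℝ) ^ (2 * s) * 2 ^ (1 - 2 * s) = 2 := by
      rw [← Real.rpow_add two_pos]
      norm_num
    have e3 : √((2 : ℕ) : ℝ) / (2 * Real.pi) ^ ((((2 : ℕ) : ℝ) - 1) / 2) = (√Real.pi)⁻¹ := by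
      rw [show (((2 : ℕ) : ℝ) - 1) / 2 = 1 / 2 by norm_num, ← Real.sqrt_eq_rpow,
        Real.sqrt_mul zero_le_two, Nat.cast_ofNat]
      have := Real.sqrt_ne_zero'.2 two_pos
      have := Real.sqrt_ne_zero'.2 Real.pi_pos
      field_simp
    have hπ := Real.sqrt_ne_zero'.2 Real.pi_pos
    rw [e1, e3]
    norm_num
    rw [show 3 / 2 - (1 - s) = s + 1 / 2 by ring,
      show -(E'.ρ / 2) + s = s - E'.ρ / 2 by ring]
    rw [← mul_assoc (Real.Gamma s), hg]
    generalize Real.Gamma (s - E'.ρ / 2) = G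
    field_simp
    linear_combination (Real.Gamma (2 * s) * G) * e2

/-- The denominator is `Γ(s - ρ_Ẽ / r_Ẽ + 1)`; against the last factor of `prod_Gamma_T₅` it leaves
`1 / (s - ρ_Ẽ / r_Ẽ)`, the factor produced by integrating the density of `γ_D`. -/
theorem optical_residue_eq (D E' : RISLink) {Z U s P ζ : ℝ} {k : ℕ} (hZ : 0 < Z) (hU : 0 < U)
    (hk : T₄ D E' k = 1 - s) (hs : 0 < s - E'.ρ / E'.r) :
    √E'.r * Z ^ (-ζ) / (2 * Real.pi) ^ (((E'.r : ℝ) - 1) / 2) *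
      ((U ^ E'.r / (E'.r : ℝ) ^ E'.r / Z) ^ (T₄ D E' k - 1) *
        ((P * ∏ l ∈ Finset.Icc 1 (E'.r + 1), Real.Gamma (1 + T₅ E' l - T₄ D E' k)) /
          ∏ l ∈ Finset.Icc (D.r + 1) (D.r + 1), Real.Gamma (1 + T₄ D E' l - T₄ D E' k))) =
      Z ^ (s - ζ) * P * (E'.r * U ^ (-(E'.r * s)) * Real.Gamma (E'.r * s)) /
        (s - E'.ρ / E'.r) := by
  have hr := E'.r_pos
  have hX : 0 < U ^ E'.r / (E'.r : ℝ) ^ E'.r := by positivity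
  have hT : T₄ D E' (D.r + 1) = 1 - E'.ρ / E'.r := by
    have h1 : D.r ≠ 0 := by rcases D.r_eq with h | h <;> omega
    simp [T₄, h1]
  rw [hk, Finset.Icc_self, Finset.prod_singleton, hT,
    show 1 + (1 - E'.ρ / E'.r) - (1 - s) = (s - E'.ρ / E'.r) + 1 by ring,
    Real.Gamma_add_one hs.ne', show 1 - s - 1 = -s by ring, Real.div_rpow hX.le hZ.le,
    sub_eq_add_neg s ζ, Real.rpow_add hZ, Real.rpow_neg hZ.le s]
  have key := E'.prod_Gamma_T₅ (s := s) hU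
  have hΓ := (Real.Gamma_pos_of_pos hs).ne'
  have hZs := (Real.rpow_pos_of_pos hZ s).ne'
  have hπ : (2 * Real.pi) ^ (((E'.r : ℝ) - 1) / 2) ≠ 0 :=
    (Real.rpow_pos_of_pos Real.two_pi_pos _).ne'
  generalize (∏ l ∈ Finset.Icc 1 (E'.r + 1), Real.Gamma (1 + T₅ E' l - (1 - s))) = Q at *
  generalize (U ^ E'.r / (E'.r : ℝ) ^ E'.r) ^ (-s) = X at *
  generalize Real.Gamma (s - E'.ρ / E'.r) = G at *
  generalize s - E'.ρ / E'.r = t at *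
  rw [show √E'.r * Z ^ (-ζ) / (2 * Real.pi) ^ (((E'.r : ℝ) - 1) / 2) *
      (X / (Z ^ s)⁻¹ * (P * Q / (t * G))) =
      Z ^ (-ζ) * Z ^ s * P / (t * G) *
        (√E'.r / (2 * Real.pi) ^ (((E'.r : ℝ) - 1) / 2) * X * Q) by field_simp, key]
  field_simp

theorem one_sub_SOP₂Inf_eq {φ : ℝ} (hφ : 0 < φ) (D E' : RISLink) {τD τE : ℝ} (hτD : 0 < τD)
    (hτE : 0 < τE) : 1 - SOP₂Inf φ D E' τD τE = opticalMain D.r φ D E' τD τE := by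
  have h1 := D.Υ₁_pos hτD
  have h2 := D.Υ₂_pos hτD
  have hU := E'.Υ₂_pos hτE
  have hr := D.r_pos
  have hΥ₄ : 0 < D.Υ₄ τD := by
    rw [D.Υ₄_eq hτD]
    positivity
  have hZ : 0 < φ * D.Υ₄ τD := by positivity
  have ha := D.shape_pos
  have hb := E'.shape_pos
  have hk1 : T₄ D E' 1 = 1 - zetaOpt D E' := by simp [T₄]
  have hs1 : zetaOpt D E' - E'.ρ / E'.r = D.ρ / D.r := by
    rw [zetaOpt]
    ring
  have r1 := fun P => optical_residue_eq D E' (P := P) (ζ := zetaOpt D E') hZ hU hk1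
    (by rw [hs1]; exact ha)
  have hM := fun s (hs : 0 ≤ s) => (E'.integrableOn_and_snrMoment_eq (s := s) hτE hs).2
  rw [SOP₂Inf, sub_sub_cancel, opticalMain, mul_assoc _ _ (Finset.sum _ _), Finset.mul_sum,
    D.Υ₃_eq]
  simp only [Ω₁₈]
  rcases D.r_eq with h | h
  · have e0 : (Finset.Icc 1 D.r).erase 1 = ∅ := by rw [h]; rfl
    have e1 : Finset.Icc 1 D.r = {1} := by rw [h]; rfl
    have e2 : Finset.range D.r = {0} := by rw [h]; rfl
    have e3 : (D.r : ℝ) = 1 := by rw [h]; norm_num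
    rw [e2, Finset.sum_singleton]
    conv_lhs => rw [e1, Finset.sum_singleton, ← e1]
    rw [e0, r1, hs1, sub_self, Real.rpow_zero, Finset.prod_empty, hM _ (by positivity),
      Nat.cast_zero, zero_div, add_zero, zetaOpt, e3]
    simp
    ring
  · have hk2 : T₄ D E' 2 = 1 - (zetaOpt D E' + 1 / 2) := by
      simp [T₄, h, RISLink.Υ₅]
      ring
    have hs2 : zetaOpt D E' + 1 / 2 - E'.ρ / E'.r = D.ρ / D.r + 1 / 2 := by
      rw [zetaOpt]
      ring
    have r2 := fun P => optical_residue_eq D E' (P := P) (ζ := zetaOpt D E') hZ hU hk2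
      (by rw [hs2]; positivity)
    have e0 : (Finset.Icc 1 D.r).erase 1 = {2} := by rw [h]; rfl
    have e0' : (Finset.Icc 1 D.r).erase 2 = {1} := by rw [h]; rfl
    have e1 : Finset.Icc 1 D.r = {1, 2} := by rw [h]; rfl
    have e3 : (D.r : ℝ) = 2 := by rw [h]; norm_num
    have hg1 : T₄ D E' 1 - T₄ D E' 2 = 1 / 2 := by rw [hk1, hk2]; ring
    have hg2 : T₄ D E' 2 - T₄ D E' 1 = -(1 / 2) := by rw [hk1, hk2]; ring
    -- With `Z ^ (1 / 2) = φ ^ (1 / 2) Υ₂ / 2` and the prefactor `1 / √π`, this value yields `-Υ₂`,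
    -- the linear coefficient of the exponential.
    have hΓ : Real.Gamma (-(1 / 2)) = -2 * √Real.pi := by
      have := Real.Gamma_add_one (s := -(1 / 2)) (by norm_num)
      rw [show -(1 / 2 : ℝ) + 1 = 1 / 2 by norm_num, Real.Gamma_one_half_eq] at this
      linarith
    have hZ2 : (φ * D.Υ₄ τD) ^ (1 / 2 : ℝ) = φ ^ (1 / 2 : ℝ) * (D.Υ₂ τD / 2) := by
      rw [D.Υ₄_eq hτD, h, ← div_pow, Real.mul_rpow hφ.le (by positivity), ← Real.sqrt_eq_rpow
        ((D.Υ₂ τD / _) ^ 2), Real.sqrt_sq (by positivity)]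
      norm_num
    have hπ := Real.sqrt_ne_zero'.2 Real.pi_pos
    have h22 := Real.sqrt_ne_zero'.2 two_pos
    have hr2 : √(D.r : ℝ) / (2 * Real.pi) ^ (((D.r : ℝ) - 1) / 2) = (√Real.pi)⁻¹ := by
      rw [e3, show ((2 : ℝ) - 1) / 2 = 1 / 2 by norm_num, ← Real.sqrt_eq_rpow,
        Real.sqrt_mul zero_le_two]
      field_simp
    conv_lhs => rw [e1, Finset.sum_pair (by norm_num), ← e1]
    rw [e0, e0', r1, r2, hs1, hs2, sub_self, Real.rpow_zero, Finset.prod_singleton,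
      Finset.prod_singleton, hg1, hg2, hΓ, Real.Gamma_one_half_eq, add_sub_cancel_left, hZ2, hr2,
      show Finset.range D.r = {0, 1} by rw [h]; rfl, Finset.sum_pair (by norm_num),
      hM _ (by positivity), hM _ (by positivity), Nat.cast_zero, zero_div, add_zero, Nat.cast_one,
      show D.ρ / D.r + 1 / D.r + E'.ρ / E'.r = zetaOpt D E' + 1 / 2 by rw [zetaOpt, e3]; ring,
      show D.ρ / D.r + E'.ρ / E'.r = zetaOpt D E' from rfl,
      show (1 : ℝ) / D.r = 1 / 2 by rw [e3], Real.rpow_add hφ]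
    simp only [pow_zero, pow_one, Nat.factorial_zero, Nat.factorial_one, Nat.cast_one, div_one]
    field_simp

/-! ### Asymptotics of `SOP₂`. -/

theorem opticalMain_one (φ : ℝ) (D E' : RISLink) (τD τE : ℝ) :
    opticalMain 1 φ D E' τD τE = D.Υ₁ τD * (φ ^ (D.ρ / D.r) / (D.ρ / D.r) *
      E'.snrMoment τE (D.ρ / D.r)) := by
  simp [opticalMain]
  ring

/-- Because `Υ₂` scales as `τD ^ (-1 / r)`, stopping after exactly `r` terms makes the remainder one
full power of `τD` smaller than `Υ₁`. -/
theorem isBigO_SOP₂_sub {φ : ℝ} (hφ : 0 < φ) (D E' : RISLink) {τE : ℝ} (hτE : 0 < τE) :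
    (fun τD : ℝ => SOP₂ φ D E' τD τE - SOP₂Inf φ D E' τD τE) =O[atTop]
      fun τD : ℝ => τD ^ (-(D.ρ / D.r + 1)) := by
  have hr := D.r_pos
  have hm : D.r ≤ 2 := by rcases D.r_eq with h | h <;> omega
  refine IsBigO.of_bound (D.Υ₁ 1 * D.Υ₂ 1 ^ D.r * (φ ^ (D.ρ / D.r + D.r / D.r) /
    (D.ρ / D.r + D.r / D.r) * E'.snrMoment τE (D.ρ / D.r + D.r / D.r))) ?_
  filter_upwards [eventually_gt_atTop 0] with τ hτ
  have hb := abs_one_sub_SOP₂_sub_opticalMain_le hm hφ D E' hτ hτE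
  rw [← one_sub_SOP₂Inf_eq hφ D E' hτ hτE, sub_sub_sub_cancel_left, D.Υ₁_eq hτ, D.Υ₂_eq hτ] at hb
  rw [Real.norm_eq_abs, abs_sub_comm, Real.norm_of_nonneg (by positivity)]
  refine hb.trans (le_of_eq ?_)
  rw [mul_pow, ← Real.rpow_natCast (τ ^ _), ← Real.rpow_mul hτ.le, neg_mul,
    one_div_mul_cancel hr.ne', neg_add, Real.rpow_add hτ]
  ring

theorem RISLink.tendsto_Υ₂ (n : RISLink) : Tendsto n.Υ₂ atTop (nhds 0) := by
  have h := (tendsto_rpow_neg_atTop (one_div_pos.2 n.r_pos)).const_mul (n.Υ₂ 1)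
  rw [mul_zero] at h
  refine h.congr' ?_
  filter_upwards [eventually_gt_atTop 0] with τ hτ
  rw [n.Υ₂_eq hτ]

theorem one_sub_SOP₂_lower_bound {φ : ℝ} (hφ : 0 < φ) (D E' : RISLink) {τE : ℝ}
    (hτE : 0 < τE) :
    ∃ c : ℝ, 0 < c ∧ ∀ᶠ τD in atTop, c * τD ^ (-(D.ρ / D.r)) ≤ 1 - SOP₂ φ D E' τD τE := by
  have ha := D.shape_pos
  have hr := D.r_pos
  set K := φ ^ (D.ρ / D.r) / (D.ρ / D.r) * E'.snrMoment τE (D.ρ / D.r) with hK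
  set K' := φ ^ (D.ρ / D.r + (1 : ℕ) / D.r) / (D.ρ / D.r + (1 : ℕ) / D.r) *
    E'.snrMoment τE (D.ρ / D.r + (1 : ℕ) / D.r)
  have hK0 : 0 < K := by
    have := E'.snrMoment_pos hτE ha.le
    positivity
  have h1 := D.Υ₁_pos one_pos
  -- The leading term is `Υ₁ K`; half of `K` is given up to absorb the correction `Υ₂ K'`, which
  -- tends to `0`.
  refine ⟨D.Υ₁ 1 * (K / 2), by positivity, ?_⟩
  have hlim : Tendsto (fun τ => D.Υ₂ τ * K') atTop (nhds 0) := by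
    simpa using (RISLink.tendsto_Υ₂ D).mul_const K'
  filter_upwards [eventually_gt_atTop 0, hlim.eventually_le_const (half_pos hK0)] with τ hτ h2
  have hb := (abs_le.1 (abs_one_sub_SOP₂_sub_opticalMain_le (m := 1) (by norm_num) hφ D E' hτ
    hτE)).1
  rw [opticalMain_one, pow_one] at hb
  change -(D.Υ₁ τ * D.Υ₂ τ * K') ≤ 1 - SOP₂ φ D E' τ τE - D.Υ₁ τ * K at hb
  have h3 := mul_le_mul_of_nonneg_left h2 (D.Υ₁_pos hτ).le
  rw [mul_right_comm, ← D.Υ₁_eq hτ]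
  linarith

/-! ### Combining the two links. -/

theorem eventually_pos_of_mul_rpow_le {u : ℝ → ℝ} {a c : ℝ} (hc : 0 < c)
    (hu : ∀ᶠ t in atTop, c * t ^ (-a) ≤ u t) : ∀ᶠ t in atTop, 0 < u t := by
  filter_upwards [hu, eventually_gt_atTop 0] with t ht ht0
  exact lt_of_lt_of_le (by positivity) ht

/-- In `1 - S₁ S₂ = (1 - S₁) + (1 - S₂) S₁` both summands are eventually nonnegative, so each is at
most the total and its relative error stays negligible. No relation between the rates of the two
variables is needed. -/
theorem isEquivalent_one_sub_mul_prod {S₁ S₁' S₂ S₂' : ℝ → ℝ}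
    (h1 : (fun t => 1 - S₁ t) ~[atTop] fun t => 1 - S₁' t)
    (h2 : (fun t => 1 - S₂ t) ~[atTop] fun t => 1 - S₂' t)
    (l1 : Tendsto (fun t => 1 - S₁ t) atTop (nhds 0))
    (p1 : ∀ᶠ t in atTop, 0 < 1 - S₁ t) (p2 : ∀ᶠ t in atTop, 0 < 1 - S₂ t) :
    (fun s : ℝ × ℝ => 1 - S₁ s.1 * S₂ s.2) ~[atTop ×ˢ atTop]
      fun s : ℝ × ℝ => 1 - S₁' s.1 * S₂' s.2 := by
  have l1' : Tendsto (fun t => 1 - S₁' t) atTop (nhds 0) := h1.tendsto_nhds l1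
  have m1 : Tendsto S₁ atTop (nhds 1) := by simpa using l1.const_sub 1
  have m1' : Tendsto S₁' atTop (nhds 1) := by simpa using l1'.const_sub 1
  have h3 : S₁ ~[atTop] S₁' := by
    have e1 := (isEquivalent_const_iff_tendsto one_ne_zero).2 m1
    have e2 := (isEquivalent_const_iff_tendsto one_ne_zero).2 m1'
    exact e1.trans e2.symm
  have f1 : Tendsto (Prod.fst : ℝ × ℝ → ℝ) (atTop ×ˢ atTop) atTop := tendsto_fst
  have f2 : Tendsto (Prod.snd : ℝ × ℝ → ℝ) (atTop ×ˢ atTop) atTop := tendsto_snd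
  have g1 : (fun s : ℝ × ℝ => 1 - S₁ s.1) ~[atTop ×ˢ atTop] fun s => 1 - S₁' s.1 :=
    h1.comp_tendsto f1
  have g2 : (fun s : ℝ × ℝ => 1 - S₂ s.2) ~[atTop ×ˢ atTop] fun s => 1 - S₂' s.2 :=
    h2.comp_tendsto f2
  have g3 : (fun s : ℝ × ℝ => S₁ s.1) ~[atTop ×ˢ atTop] fun s => S₁' s.1 :=
    h3.comp_tendsto f1
  have g4 := g2.mul g3
  have q1 : ∀ᶠ s : ℝ × ℝ in atTop ×ˢ atTop, 0 ≤ 1 - S₁ s.1 :=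
    (f1.eventually p1).mono fun _ h => h.le
  have q2 : ∀ᶠ s : ℝ × ℝ in atTop ×ˢ atTop, 0 ≤ (1 - S₂ s.2) * S₁ s.1 := by
    filter_upwards [f2.eventually p2, f1.eventually (m1.eventually_const_lt one_pos)] with s a b
    exact (mul_pos a b).le
  have d1 := g1.symm.isLittleO
  have d2 := g4.symm.isLittleO
  refine IsEquivalent.symm ?_
  have b1 : (fun s : ℝ × ℝ => 1 - S₁ s.1) =O[atTop ×ˢ atTop]
      fun s => 1 - S₁ s.1 * S₂ s.2 := by
    refine IsBigO.of_bound 1 ?_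
    filter_upwards [q1, q2] with s a b
    rw [one_mul, Real.norm_of_nonneg a, Real.norm_of_nonneg (by linarith)]
    linarith
  have b2 : (fun s : ℝ × ℝ => (1 - S₂ s.2) * S₁ s.1) =O[atTop ×ˢ atTop]
      fun s => 1 - S₁ s.1 * S₂ s.2 := by
    refine IsBigO.of_bound 1 ?_
    filter_upwards [q1, q2] with s a b
    rw [one_mul, Real.norm_of_nonneg b, Real.norm_of_nonneg (by linarith)]
    linarith
  refine ((d1.trans_isBigO b1).add (d2.trans_isBigO b2)).congr_left fun s => ?_
  simp only [Pi.sub_apply, Pi.mul_apply]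
  ring

theorem mainTheorem10 (p : ℕ) (hp : 1 ≤ p) (Rs : ℝ) (hRs : 0 < Rs)
    (R E : RFLink) (D E' : RISLink) (hIn : D.hopIn = E'.hopIn) (hN : D.N = E'.N)
    (hres : ∀ (i : Fin 3) (z : ℤ), E.Ψ i - R.L * R.μ ≠ z)
    (γE τE : ℝ) (hγE : 0 < γE) (hτE : 0 < τE) :
    Asymptotics.IsEquivalent (Filter.atTop ×ˢ Filter.atTop)
        (fun s : ℝ × ℝ => SOPIII p (2 ^ Rs) R E D E' s.1 γE s.2 τE)
        (fun s : ℝ × ℝ => SOPIIIInf p (2 ^ Rs) R E D E' s.1 γE s.2 τE) ∧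
      Asymptotics.IsEquivalent Filter.atTop
        (fun γR : ℝ => 1 - SOP₁ p (2 ^ Rs) R E γR γE)
        (fun γR : ℝ => 1 - SOP₁Inf p (2 ^ Rs) R E γR γE) ∧
      Asymptotics.IsEquivalent Filter.atTop
        (fun τD : ℝ => 1 - SOP₂ (2 ^ Rs) D E' τD τE)
        (fun τD : ℝ => 1 - SOP₂Inf (2 ^ Rs) D E' τD τE) ∧
      Asymptotics.IsBigO Filter.atTop
        (fun γR : ℝ => SOP₁ p (2 ^ Rs) R E γR γE - SOP₁Inf p (2 ^ Rs) R E γR γE)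
        (fun γR : ℝ => γR ^ (-(R.L * R.μ + 1))) ∧
      Asymptotics.IsBigO Filter.atTop
        (fun τD : ℝ => SOP₂ (2 ^ Rs) D E' τD τE - SOP₂Inf (2 ^ Rs) D E' τD τE)
        (fun τD : ℝ => τD ^ (-(D.ρ / D.r + 1))) := by
  have hφ : (0 : ℝ) < 2 ^ Rs := Real.rpow_pos_of_pos two_pos Rs
  have o1 := isBigO_SOP₁_sub p hφ R E hres hγE
  have o2 := isBigO_SOP₂_sub hφ D E' hτE
  obtain ⟨c₁, hc₁, b1⟩ := one_sub_SOP₁_lower_bound hp hφ R E hres hγE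
  obtain ⟨c₂, hc₂, b2⟩ := one_sub_SOP₂_lower_bound hφ D E' hτE
  have e1 : (fun γR : ℝ => 1 - SOP₁ p (2 ^ Rs) R E γR γE) ~[atTop]
      fun γR : ℝ => 1 - SOP₁Inf p (2 ^ Rs) R E γR γE :=
    isEquivalent_of_isBigO_sub_of_le hc₁ (o1.neg_left.congr_left fun t => by ring) b1
  have e2 : (fun τD : ℝ => 1 - SOP₂ (2 ^ Rs) D E' τD τE) ~[atTop]
      fun τD : ℝ => 1 - SOP₂Inf (2 ^ Rs) D E' τD τE :=
    isEquivalent_of_isBigO_sub_of_le hc₂ (o2.neg_left.congr_left fun t => by ring) b2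
  exact ⟨isEquivalent_one_sub_mul_prod e1 e2
    (e1.symm.tendsto_nhds (tendsto_one_sub_SOP₁Inf p hφ R E hres hγE))
    (eventually_pos_of_mul_rpow_le hc₁ b1) (eventually_pos_of_mul_rpow_le hc₂ b2), e1, e2, o1, o2⟩
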